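/- All vector spaces are over $\mathbb C$, $\delta(z)=\sum_{n\in\mathbb Z}z^n$, and powers of binomials are expanded in nonnegative powers of the second variable. A Möbius vertex algebra is a vector space $V=\coprod_{n\in\mathbb Z}V_n$ with a linear map $v\mapsto Y(v,x)=\sum_{n\in\mathbb Z}v_nx^{-n-1}\in(\operatorname{End}V)[[x,x^{-1}]]$ and a vector $\mathbf 1\in V_0$ such that, for all $u,v\in V$: $u_nv=0$ for $n$ sufficiently large; $Y(\mathbf 1,x)=1_V$; $Y(v,x)\mathbf 1\in V[[x]]$ with constant term $v$; the Jacobi identity $$x_0^{-1}\delta\Big(\frac{x_1-x_2}{x_0}\Big)Y(u,x_1)Y(v,x_2)-x_0^{-1}\delta\Big(\frac{x_2-x_1}{-x_0}\Big)Y(v,x_2)Y(u,x_1)=x_2^{-1}\delta\Big(\frac{x_1-x_0}{x_2}\Big)Y(Y(u,x_0)v,x_2)$$ holds; and together with operators $L(-1),L(0),L(1)$ on $V$ satisfying $[L(0),L(-1)]=L(-1)$, $[L(0),L(1)]=-L(1)$, $[L(-1),L(1)]=-2L(0)$, $[L(j),Y(u,x)]=\sum_{k=0}^{j+1}\binom{j+1}{k}x^{j+1-k}Y(L(k-1)u,x)$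 for $j=-1,0,1$, $\frac{d}{dx}Y(v,x)=Y(L(-1)v,x)$, and $L(0)v=nv$ for $v\in V_n$. It is $\mathbb N$-graded if $V_n=0$ for $n<0$. Put $C_2(V)=\operatorname{span}\{u_{-2}v: u,v\in V\}$. A quasimodule for $V$ is a vector space $W$ with a linear map $v\mapsto Y_W(v,x)=\sum_{n\in\mathbb Z}v_nx^{-n-1}\in(\operatorname{End}W)[[x,x^{-1}]]$ such that $v_nw=0$ for $n$ sufficiently large (for each $v\in V$, $w\in W$); $Y_W(\mathbf 1,x)=1_W$; for all $u,v\in V$ there is a nonzero polynomial $f(x_1,x_2)\in\mathbb C[x_1,x_2]$ for which the Jacobi identity, with $Y_W$ in place of the outer vertex operators $Y$, holds on $W$ after both sides are multiplied by $f(x_1,x_2)$; and together with operators $L_W(-1),L_W(0),L_W(1)$ on $W$ that satisfy the same $\mathfrak{sl}(2)$ bracket relations, $[L_W(j),Y_W(u,x)]=\sum_{k=0}^{j+1}\binom{j+1}{k}x^{j+1-k}Y_W(L(k-1)u,x)$ for $j=-1,0,1$, and $\frac{d}{dx}Y_W(v,x)=Y_W(L(-1)v,x)$. It is generated by $w\in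 W$ if $W$ is the smallest subspace that contains $w$ and is stable under all $v_n$ ($v\in V$, $n\in\mathbb Z$). A vector $w\in W$ is uniformly annihilated by $X\subseteq V$ if there is $T\in\mathbb N=\{0,1,2,\dots\}$ such that $x_nw=0$ for all $x\in X$ and all $n\ge T$; the smallest such $T$ is the order of uniform annihilation of $w$ by $X$. **Theorem 5.1.** Let $V$ be an $\mathbb N$-graded Möbius vertex algebra, and let $X\subseteq V$ be a set of homogeneous representatives of a basis of $V/C_2(V)$ (each element of $X$ lies in some $V_n$, and $X$ maps bijectively onto a basis of $V/C_2(V)$). Let $W$ be a quasimodule for $V$ generated by a vector $w$ that is uniformly annihilated by $X$, with order of uniform annihilation $T$. Then $W$ is spanned by the elements $$x^{(1)}_{n_1}\cdots x^{(r)}_{n_r}w$$ with $r\in\mathbb N$, $x^{(1)},\dots,x^{(r)}\in X$, $n_1,\dots,n_r\in\mathbb Z$ and $n_1<\cdots<n_r<T$ (for $r=0$ the element is $w$). -/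

import Mathlib

/-! ### Formal calculus

A formal series `∑ A b c x₁ᵇ x₂ᶜ` (infinite in all directions) with coefficients in `W` is the
function `A : ℤ → ℤ → W` of its coefficients, and a formal series in `x₀, x₁, x₂` is a function
`D : ℤ → ℤ → ℤ → W`, where `D a b c` is the coefficient of `x₀ᵃ x₁ᵇ x₂ᶜ`.  As usual
`δ(z) = ∑ n : ℤ, zⁿ`, and `(x - y)ⁿ = ∑ k ≥ 0, (-1)ᵏ (n choose k) xⁿ⁻ᵏ yᵏ` for every integer `n`,
that is, binomials are expanded in nonnegative powers of their second variable. -/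

section FormalCalculus

variable {W : Type*} [AddCommGroup W] [Module ℂ W]

/-- The product `x₀⁻¹ δ((x₁ - x₂) / x₀) A(x₁, x₂)`.  The delta factor is
`∑ n, ∑ k ≥ 0, (-1)ᵏ (n choose k) x₀⁻ⁿ⁻¹ x₁ⁿ⁻ᵏ x₂ᵏ`, so only `n = -a - 1` contributes to the
coefficient of `x₀ᵃ`.  The sum is finite when the powers of `x₂` in `A` are bounded below. -/
noncomputable def deltaMul₁₂ (A : ℤ → ℤ → W) (a b c : ℤ) : W :=
  ∑ᶠ k : ℕ, ((-1) ^ k * Ring.choose (-a - 1) k : ℤ) • A (b - (-a - 1 - k)) (c - k)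

/-- The product `x₀⁻¹ δ((x₂ - x₁) / (-x₀)) B(x₁, x₂)`.  The delta factor is
`∑ n, ∑ k ≥ 0, (-1)ⁿ (-1)ᵏ (n choose k) x₀⁻ⁿ⁻¹ x₁ᵏ x₂ⁿ⁻ᵏ`.  The sum is finite when the powers of
`x₁` in `B` are bounded below. -/
noncomputable def deltaMul₂₁ (B : ℤ → ℤ → W) (a b c : ℤ) : W :=
  ∑ᶠ k : ℕ, (((-a - 1).negOnePow : ℤ) * ((-1) ^ k * Ring.choose (-a - 1) k)) •
    B (b - k) (c - (-a - 1 - k))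

/-- The product `x₂⁻¹ δ((x₁ - x₀) / x₂) E(x₀, x₂)`.  The delta factor is
`∑ n, ∑ k ≥ 0, (-1)ᵏ (n choose k) x₀ᵏ x₁ⁿ⁻ᵏ x₂⁻ⁿ⁻¹`, so only the pairs with `n = b + k` contribute
to the coefficient of `x₁ᵇ`.  The sum is finite when the powers of `x₀` in `E` are bounded below. -/
noncomputable def deltaMul₁₀ (E : ℤ → ℤ → W) (a b c : ℤ) : W :=
  ∑ᶠ k : ℕ, ((-1) ^ k * Ring.choose (b + k) k : ℤ) • E (a - k) (c + (b + k) + 1)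

/-- The product `f(x₁, x₂) D(x₀, x₁, x₂)` of a formal series with a polynomial, whose variables
`X 0` and `X 1` are `x₁` and `x₂`. -/
noncomputable def polyMul (f : MvPolynomial (Fin 2) ℂ) (D : ℤ → ℤ → ℤ → W) (a b c : ℤ) : W :=
  ∑ m ∈ f.support, f.coeff m • D a (b - m 0) (c - m 1)

end FormalCalculus

/-- A Möbius vertex algebra structure on the complex vector space `V`. -/
structure MobiusVertexAlgebra (V : Type*) [AddCommGroup V] [Module ℂ V] where
  /-- The homogeneous subspaces `V_n`. -/
  grade : ℤ → Submodule ℂ V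
  grade_internal : DirectSum.IsInternal grade
  /-- The vertex operator map through its modes: `Y(v, x) = ∑ n, mode v n x⁻ⁿ⁻¹`. -/
  mode : V →ₗ[ℂ] ℤ → Module.End ℂ V
  /-- The vacuum vector. -/
  vac : V
  vac_mem : vac ∈ grade 0
  /-- Lower truncation. -/
  truncation : ∀ u v : V, ∃ N : ℤ, ∀ n ≥ N, mode u n v = 0
  /-- `Y(1, x) = 1`. -/
  vacuum : ∀ n : ℤ, mode vac n = if n = -1 then 1 else 0
  /-- Creation property, part one: `Y(v, x) 1` has no negative powers of `x`. -/
  creation_regular : ∀ (v : V) (n : ℤ), 0 ≤ n → mode v n vac = 0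
  /-- Creation property, part two: the constant term of `Y(v, x) 1` is `v`. -/
  creation_limit : ∀ v : V, mode v (-1) vac = v
  /-- The Jacobi identity, applied to a vector `w`.  The coefficient of `x₁ᵇ x₂ᶜ` in
  `Y(u, x₁) Y(v, x₂) w` is `u_{-b-1} v_{-c-1} w`, and so on. -/
  jacobi : ∀ u v w : V,
    deltaMul₁₂ (fun b c => mode u (-b - 1) (mode v (-c - 1) w))
      - deltaMul₂₁ (fun b c => mode v (-c - 1) (mode u (-b - 1) w))
      = deltaMul₁₀ (fun a c => mode (mode u (-a - 1) v) (-c - 1) w)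
  /-- The operators of the representation of `sl(2)`: `L 0`, `L 1`, `L 2` are the operators
  usually denoted `L(-1)`, `L(0)`, `L(1)`, so that `L i` is `L(i - 1)`. -/
  L : Fin 3 → Module.End ℂ V
  /-- `[L(0), L(-1)] = L(-1)`. -/
  L_zero_neg : ⁅L 1, L 0⁆ = L 0
  /-- `[L(0), L(1)] = -L(1)`. -/
  L_zero_pos : ⁅L 1, L 2⁆ = -L 2
  /-- `[L(-1), L(1)] = -2 L(0)`. -/
  L_neg_pos : ⁅L 0, L 2⁆ = (-2 : ℂ) • L 1
  /-- `[L(j), Y(u, x)] = ∑ k ∈ {0, …, j + 1}, (j + 1 choose k) x^(j + 1 - k) Y(L(k - 1) u, x)`,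
  with `i = j + 1`, in the coefficient of `x⁻ⁿ⁻¹`; the terms with `k > i` vanish. -/
  L_mode : ∀ (i : Fin 3) (u : V) (n : ℤ),
    ⁅L i, mode u n⁆ = ∑ k : Fin 3,
      (i : ℕ).choose (k : ℕ) • mode (L k u) (n + ((i : ℕ) : ℤ) - ((k : ℕ) : ℤ))
  /-- `d/dx Y(v, x) = Y(L(-1) v, x)`, in the coefficient of `x⁻ⁿ⁻¹`. -/
  derivative : ∀ (v : V) (n : ℤ), (-n : ℂ) • mode v (n - 1) = mode (L 0 v) n
  /-- `L(0)` acts on `V_n` as `n`. -/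
  L_zero_grade : ∀ (n : ℤ), ∀ v ∈ grade n, L 1 v = (n : ℂ) • v

namespace MobiusVertexAlgebra

variable {V : Type*} [AddCommGroup V] [Module ℂ V]

/-- `V_n = 0` for all `n < 0`. -/
def IsNGraded (A : MobiusVertexAlgebra V) : Prop :=
  ∀ n : ℤ, n < 0 → A.grade n = ⊥

/-- `C₂(V)`, the span of all `u_{-2} v`. -/
def C₂ (A : MobiusVertexAlgebra V) : Submodule ℂ V :=
  Submodule.span ℂ {y | ∃ u v : V, y = A.mode u (-2) v}

/-- `X` is a set of homogeneous representatives of a basis of `V / C₂(V)`: its elements are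
homogeneous, and their classes are linearly independent (in particular pairwise distinct) and
span the quotient. -/
structure IsHomogeneousC₂Basis (A : MobiusVertexAlgebra V) (X : Set V) : Prop where
  homogeneous : ∀ x ∈ X, ∃ n : ℤ, x ∈ A.grade n
  linearIndependent : LinearIndependent ℂ (fun x : X => A.C₂.mkQ (x : V))
  span_eq_top : Submodule.span ℂ (A.C₂.mkQ '' X) = ⊤

/-- A quasimodule structure on the complex vector space `W` for a Möbius vertex algebra. -/
structure Quasimodule (A : MobiusVertexAlgebra V) (W : Type*) [AddCommGroup W] [Module ℂ W] where
  /-- The vertex operator map through its modes: `Y_W(v, x) = ∑ n, mode v n x⁻ⁿ⁻¹`. -/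
  mode : V →ₗ[ℂ] ℤ → Module.End ℂ W
  /-- Lower truncation. -/
  truncation : ∀ (v : V) (w : W), ∃ N : ℤ, ∀ n ≥ N, mode v n w = 0
  /-- `Y_W(1, x) = 1`. -/
  vacuum : ∀ n : ℤ, mode A.vac n = if n = -1 then 1 else 0
  /-- The quasi-Jacobi identity; the polynomial depends on `u` and `v` only. -/
  quasiJacobi : ∀ u v : V, ∃ f : MvPolynomial (Fin 2) ℂ, f ≠ 0 ∧ ∀ w : W,
    polyMul f (deltaMul₁₂ (fun b c => mode u (-b - 1) (mode v (-c - 1) w)))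
      - polyMul f (deltaMul₂₁ (fun b c => mode v (-c - 1) (mode u (-b - 1) w)))
      = polyMul f (deltaMul₁₀ (fun a c => mode (A.mode u (-a - 1) v) (-c - 1) w))
  /-- The operators of the representation of `sl(2)` on `W`: `L i` is `L_W(i - 1)`. -/
  L : Fin 3 → Module.End ℂ W
  /-- `[L(0), L(-1)] = L(-1)`. -/
  L_zero_neg : ⁅L 1, L 0⁆ = L 0
  /-- `[L(0), L(1)] = -L(1)`. -/
  L_zero_pos : ⁅L 1, L 2⁆ = -L 2
  /-- `[L(-1), L(1)] = -2 L(0)`. -/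
  L_neg_pos : ⁅L 0, L 2⁆ = (-2 : ℂ) • L 1
  /-- `[L_W(j), Y_W(u, x)] = ∑ k ∈ {0, …, j + 1}, (j + 1 choose k) x^(j + 1 - k)
  Y_W(L(k - 1) u, x)`, with `i = j + 1`, in the coefficient of `x⁻ⁿ⁻¹`. -/
  L_mode : ∀ (i : Fin 3) (u : V) (n : ℤ),
    ⁅L i, mode u n⁆ = ∑ k : Fin 3,
      (i : ℕ).choose (k : ℕ) • mode (A.L k u) (n + ((i : ℕ) : ℤ) - ((k : ℕ) : ℤ))
  /-- `d/dx Y_W(v, x) = Y_W(L(-1) v, x)`, in the coefficient of `x⁻ⁿ⁻¹`. -/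
  derivative : ∀ (v : V) (n : ℤ), (-n : ℂ) • mode v (n - 1) = mode (A.L 0 v) n

namespace Quasimodule

variable {A : MobiusVertexAlgebra V} {W : Type*} [AddCommGroup W] [Module ℂ W]

/-- `W` is generated by `w`: the only subspace that contains `w` and is stable under all modes
`v_n` is `W` itself. -/
def IsGeneratedBy (M : A.Quasimodule W) (w : W) : Prop :=
  ∀ S : Submodule ℂ W, w ∈ S → (∀ (v : V) (n : ℤ), ∀ y ∈ S, M.mode v n y ∈ S) → S = ⊤

/-- The set of all `T : ℕ` such that `x_n w = 0` for all `x ∈ X` and `n ≥ T`. -/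
def annihilationBounds (M : A.Quasimodule W) (X : Set V) (w : W) : Set ℕ :=
  {T | ∀ x ∈ X, ∀ n : ℤ, (T : ℤ) ≤ n → M.mode x n w = 0}

/-- `w` is uniformly annihilated by `X`. -/
def IsUniformlyAnnihilated (M : A.Quasimodule W) (X : Set V) (w : W) : Prop :=
  (M.annihilationBounds X w).Nonempty

/-- The order of uniform annihilation of `w` by `X`, the smallest element of
`annihilationBounds` (meaningful when `w` is uniformly annihilated by `X`). -/
noncomputable def annihilationOrder (M : A.Quasimodule W) (X : Set V) (w : W) : ℕ :=
  sInf (M.annihilationBounds X w)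

/-- The monomial `x⁽¹⁾_{n₁} ⋯ x⁽ʳ⁾_{nᵣ} w` of the list `[(x⁽¹⁾, n₁), …, (x⁽ʳ⁾, nᵣ)]`; it is `w`
for the empty list. -/
def monomial (M : A.Quasimodule W) (l : List (V × ℤ)) (w : W) : W :=
  l.foldr (fun p y => M.mode p.1 p.2 y) w

end Quasimodule

end MobiusVertexAlgebra

/-!
The representation of `sl(2)` forces every quasimodule to be a module, and for modules the
spanning set is found as in the theory of `C₂`-cofiniteness.

**The Jacobi identity.**  Fix `u` and `v` homogeneous, and let `J_w(x₀, x₁, x₂)` be the difference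
of the two sides of the Jacobi identity on `w`.  The Laurent polynomials that kill all `J_w` form an
ideal, which contains `x₁ - x₂ - x₀`, since each of the three delta functions satisfies
`(x₁ - x₂) δ = x₀ δ`.  By assumption it contains a nonzero polynomial in `x₁` and `x₂`.  The
commutator formula for `L(-1)` makes the ideal stable under `∂₁ + ∂₂`, which is `∂ / ∂x₂` in the
coordinates `x₀ = x₁ - x₂` and `x₂`; so differentiation leads to a nonzero polynomial in `x₀` alone.
The commutator formula for `L(0)` makes the ideal stable under `x₀ ∂₀`, hence under `∂₀`, as `x₀`
is a unit; so differentiation leads to a nonzero constant, and `J_w = 0`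
(`family_eq_zero_of_polynomial_annihilates`, `jacobiDefect_eq_zero`).

**The spanning set.**  Filter `W` by the total weight of monomials in modes of homogeneous vectors
applied to `w`.  Since `u_i v` has weight less than `wt u + wt v` for `i ≥ 0`, modes commute modulo
lower weight, and `(a_{-2} b)_n` has lower weight than `a_{-2} b` suggests.  So modulo lower weight
only monomials in `X` matter, their letters can be reordered, and they vanish as soon as an index
is at least the order of uniform annihilation `T`.  Modulo lower weight and shorter monomials,
`(u_{-1} v)_{2n+1}` gives the relation `∑ u_p v_q = 0` over `p + q = 2n`, which replaces a repeated
index `n` by pairs `n + j`, `n - j` with `j ≠ 0`.  This increases `∑ (T - nᵢ)²`, while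
`∑ (T - nᵢ)` stays the same and all `T - nᵢ` are positive, so the process stops (`monomial_mem_of_weight`).
-/

/-! ### Binomial coefficients -/

theorem succ_mul_ringChoose_succ (n : ℤ) (k : ℕ) :
    ((k : ℤ) + 1) * Ring.choose n (k + 1) = (n - k) * Ring.choose n k := by
  have h := Ring.choose_smul_choose n (Nat.le_succ k)
  rw [Nat.choose_succ_self_right, Nat.succ_sub (le_refl k), Nat.sub_self, Ring.choose_one_right,
    nsmul_eq_mul] at h
  push_cast at h
  rw [h, mul_comm]

theorem ringChoose_neg_one (k : ℕ) : Ring.choose (-1 : ℤ) k = (-1) ^ k := by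
  induction k with
  | zero => simp
  | succ k ih =>
    have h := Ring.choose_succ_succ (-1 : ℤ) k
    rw [neg_add_cancel, Ring.choose_zero_succ, ih] at h
    rw [pow_succ]
    linarith

/-! ### Products of truncated series with delta functions -/

section DeltaProducts

open Filter

variable {W : Type*} [AddCommGroup W]

theorem eventually_finsum_eq_sum_range {g : ℕ → W} (hg : ∀ᶠ k in atTop, g k = 0) :
    ∀ᶠ N in atTop, ∑ᶠ k, g k = ∑ k ∈ Finset.range N, g k := by
  obtain ⟨K, hK⟩ := eventually_atTop.1 hg
  refine eventually_atTop.2 ⟨K, fun N hN => finsum_eq_sum_of_support_subset _ fun k hk => ?_⟩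
  simp only [Finset.coe_range, Set.mem_Iio]
  by_contra h
  exact hk (hK k (by omega))

/-- A double series whose second exponents are bounded below, uniformly in the first exponent. -/
def IsTruncatedRight (A : ℤ → ℤ → W) : Prop := ∃ c₀ : ℤ, ∀ b c, c < c₀ → A b c = 0

/-- A double series whose first exponents are bounded below, uniformly in the second exponent. -/
def IsTruncatedLeft (A : ℤ → ℤ → W) : Prop := ∃ c₀ : ℤ, ∀ b c, b < c₀ → A b c = 0

theorem eventually_deltaMul₁₂_eq {A : ℤ → ℤ → W} (hA : IsTruncatedRight A) (a b c : ℤ) :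
    ∀ᶠ N in atTop, deltaMul₁₂ A a b c = ∑ k ∈ Finset.range N,
      ((-1) ^ k * Ring.choose (-a - 1) k : ℤ) • A (b - (-a - 1 - k)) (c - k) := by
  obtain ⟨c₀, h⟩ := hA
  refine eventually_finsum_eq_sum_range (eventually_atTop.2 ⟨(c - c₀ + 1).toNat, fun k hk => ?_⟩)
  rw [h _ _ (by omega), smul_zero]

theorem eventually_deltaMul₁₀_eq {E : ℤ → ℤ → W} (hE : IsTruncatedLeft E) (a b c : ℤ) :
    ∀ᶠ N in atTop, deltaMul₁₀ E a b c = ∑ k ∈ Finset.range N,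
      ((-1) ^ k * Ring.choose (b + k) k : ℤ) • E (a - k) (c + (b + k) + 1) := by
  obtain ⟨c₀, h⟩ := hE
  refine eventually_finsum_eq_sum_range (eventually_atTop.2 ⟨(a - c₀ + 1).toNat, fun k hk => ?_⟩)
  rw [h _ _ (by omega), smul_zero]

/-- The second delta product is, up to sign, the first one with the two variables exchanged. -/
theorem deltaMul₂₁_eq {B : ℤ → ℤ → W} (hB : IsTruncatedLeft B) (a b c : ℤ) :
    deltaMul₂₁ B a b c =
      ((-a - 1).negOnePow : ℤ) • deltaMul₁₂ (fun c b => B b c) a c b := by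
  obtain ⟨b₀, h⟩ := hB
  have h₁ := eventually_deltaMul₁₂_eq (A := fun c b => B b c) ⟨b₀, fun c b hb => h b c hb⟩ a c b
  have h₂ : ∀ᶠ N in atTop, deltaMul₂₁ B a b c = ∑ k ∈ Finset.range N,
      (((-a - 1).negOnePow : ℤ) * ((-1) ^ k * Ring.choose (-a - 1) k)) •
        B (b - k) (c - (-a - 1 - k)) := by
    refine eventually_finsum_eq_sum_range (eventually_atTop.2 ⟨(b - b₀ + 1).toNat, fun k hk => ?_⟩)
    rw [h _ _ (by omega), smul_zero]
  obtain ⟨N, h₁, h₂⟩ := (h₁.and h₂).exists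
  rw [h₁, h₂, Finset.smul_sum]
  exact Finset.sum_congr rfl fun k _ => mul_smul _ _ _

theorem IsTruncatedRight.swap {A : ℤ → ℤ → W} (hA : IsTruncatedRight A) :
    IsTruncatedLeft (fun b c => A c b) :=
  let ⟨c₀, h⟩ := hA; ⟨c₀, fun b c hb => h c b hb⟩

theorem IsTruncatedLeft.swap {A : ℤ → ℤ → W} (hA : IsTruncatedLeft A) :
    IsTruncatedRight (fun b c => A c b) :=
  let ⟨c₀, h⟩ := hA; ⟨c₀, fun b c hb => h c b hb⟩

/-! #### Compatibility with linear maps -/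

/-- If a linear map `ℓ` sends `A` to `A' + A''` coefficientwise, it does so after the product with
the delta function. -/
theorem deltaMul₁₂_map [Module ℂ W] {A A' A'' : ℤ → ℤ → W} (hA : IsTruncatedRight A)
    (hA' : IsTruncatedRight A') (hA'' : IsTruncatedRight A'') (ℓ : Module.End ℂ W)
    (h : ∀ b c, ℓ (A b c) = A' b c + A'' b c) (a b c : ℤ) :
    ℓ (deltaMul₁₂ A a b c) = deltaMul₁₂ A' a b c + deltaMul₁₂ A'' a b c := by
  obtain ⟨N, h₁, h₂, h₃⟩ := ((eventually_deltaMul₁₂_eq hA a b c).and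
    ((eventually_deltaMul₁₂_eq hA' a b c).and (eventually_deltaMul₁₂_eq hA'' a b c))).exists
  simp only [h₁, h₂, h₃, map_sum, map_zsmul, h, smul_add, Finset.sum_add_distrib]

theorem deltaMul₂₁_map [Module ℂ W] {A A' A'' : ℤ → ℤ → W} (hA : IsTruncatedLeft A)
    (hA' : IsTruncatedLeft A') (hA'' : IsTruncatedLeft A'') (ℓ : Module.End ℂ W)
    (h : ∀ b c, ℓ (A b c) = A' b c + A'' b c) (a b c : ℤ) :
    ℓ (deltaMul₂₁ A a b c) = deltaMul₂₁ A' a b c + deltaMul₂₁ A'' a b c := by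
  rw [deltaMul₂₁_eq hA, deltaMul₂₁_eq hA', deltaMul₂₁_eq hA'', map_zsmul,
    deltaMul₁₂_map hA.swap hA'.swap hA''.swap ℓ (fun c b => h b c), smul_add]

theorem deltaMul₁₀_map [Module ℂ W] {A A' A'' : ℤ → ℤ → W} (hA : IsTruncatedLeft A)
    (hA' : IsTruncatedLeft A') (hA'' : IsTruncatedLeft A'') (ℓ : Module.End ℂ W)
    (h : ∀ b c, ℓ (A b c) = A' b c + A'' b c) (a b c : ℤ) :
    ℓ (deltaMul₁₀ A a b c) = deltaMul₁₀ A' a b c + deltaMul₁₀ A'' a b c := by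
  obtain ⟨N, h₁, h₂, h₃⟩ := ((eventually_deltaMul₁₀_eq hA a b c).and
    ((eventually_deltaMul₁₀_eq hA' a b c).and (eventually_deltaMul₁₀_eq hA'' a b c))).exists
  simp only [h₁, h₂, h₃, map_sum, map_zsmul, h, smul_add, Finset.sum_add_distrib]

/-! #### Multiplication by `x₀` and by `x₁ - x₂` -/

theorem deltaMul₁₂_sub_one {A : ℤ → ℤ → W} (hA : IsTruncatedRight A) (a b c : ℤ) :
    deltaMul₁₂ A (a - 1) b c = deltaMul₁₂ A a (b - 1) c - deltaMul₁₂ A a b (c - 1) := by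
  obtain ⟨N, h₁, h₂, h₃⟩ :=
    (((tendsto_add_atTop_nat 1).eventually (eventually_deltaMul₁₂_eq hA (a - 1) b c)).and
    (((tendsto_add_atTop_nat 1).eventually (eventually_deltaMul₁₂_eq hA a (b - 1) c)).and
      (eventually_deltaMul₁₂_eq hA a b (c - 1)))).exists
  rw [h₁, h₂, h₃, Finset.sum_range_succ', Finset.sum_range_succ', add_sub_right_comm,
    ← Finset.sum_sub_distrib]
  congr 1
  · refine Finset.sum_congr rfl fun k _ => ?_
    have e : -(a - 1) - 1 = (-a - 1) + 1 := by ring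
    rw [e, Ring.choose_succ_succ]
    push_cast
    rw [show b - (-a - 1 + 1 - ((k : ℤ) + 1)) = b - (-a - 1 - k) by ring,
      show b - 1 - (-a - 1 - ((k : ℤ) + 1)) = b - (-a - 1 - k) by ring,
      show c - 1 - (k : ℤ) = c - (k + 1) by ring, ← sub_smul]
    congr 1
    ring
  · simp only [Ring.choose_zero_right]
    congr 2
    push_cast
    ring

theorem deltaMul₂₁_sub_one {A : ℤ → ℤ → W} (hA : IsTruncatedLeft A) (a b c : ℤ) :
    deltaMul₂₁ A (a - 1) b c = deltaMul₂₁ A a (b - 1) c - deltaMul₂₁ A a b (c - 1) := by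
  simp only [deltaMul₂₁_eq hA, deltaMul₁₂_sub_one hA.swap]
  rw [show -(a - 1) - 1 = (-a - 1) + 1 by ring, Int.negOnePow_succ]
  push_cast
  module

theorem deltaMul₁₀_sub_one {E : ℤ → ℤ → W} (hE : IsTruncatedLeft E) (a b c : ℤ) :
    deltaMul₁₀ E (a - 1) b c = deltaMul₁₀ E a (b - 1) c - deltaMul₁₀ E a b (c - 1) := by
  obtain ⟨N, h₁, h₂, h₃⟩ := ((eventually_deltaMul₁₀_eq hE (a - 1) b c).and
    (((tendsto_add_atTop_nat 1).eventually (eventually_deltaMul₁₀_eq hE a (b - 1) c)).and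
    ((tendsto_add_atTop_nat 1).eventually (eventually_deltaMul₁₀_eq hE a b (c - 1))))).exists
  rw [h₁, h₂, h₃, Finset.sum_range_succ', Finset.sum_range_succ', add_sub_add_comm,
    ← Finset.sum_sub_distrib]
  simp only [Ring.choose_zero_right]
  rw [show c + (b - 1 + ((0 : ℕ) : ℤ)) + 1 = c - 1 + (b + ((0 : ℕ) : ℤ)) + 1 by ring, sub_self,
    add_zero]
  refine Finset.sum_congr rfl fun k _ => ?_
  have e : b + ((k + 1 : ℕ) : ℤ) = (b + k) + 1 := by push_cast; ring
  rw [e, Ring.choose_succ_succ, show b - 1 + ((k + 1 : ℕ) : ℤ) = b + k by push_cast; ring]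
  push_cast
  rw [show a - 1 - (k : ℤ) = a - (k + 1) by ring,
    show c - 1 + (b + (k : ℤ) + 1) + 1 = c + (b + k) + 1 by ring, ← sub_smul]
  congr 1
  ring

/-! #### The translation operator `∂₁ + ∂₂` -/

theorem deltaMul₁₂_translation {A : ℤ → ℤ → W} (hA : IsTruncatedRight A)
    (hA' : IsTruncatedRight (fun b c => (b + 1) • A (b + 1) c + (c + 1) • A b (c + 1)))
    (a b c : ℤ) :
    deltaMul₁₂ (fun b c => (b + 1) • A (b + 1) c + (c + 1) • A b (c + 1)) a b c =
      (b + 1) • deltaMul₁₂ A a (b + 1) c + (c + 1) • deltaMul₁₂ A a b (c + 1) := by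
  obtain ⟨c₀, hc₀⟩ := id hA
  obtain ⟨N, h₁, h₂, h₃, hN⟩ := ((eventually_deltaMul₁₂_eq hA' a b c).and
    ((eventually_deltaMul₁₂_eq hA a (b + 1) c).and
    ((eventually_deltaMul₁₂_eq hA a b (c + 1)).and
      (eventually_ge_atTop (c - c₀ + 2).toNat)))).exists
  rw [h₁, h₂, h₃, Finset.smul_sum, Finset.smul_sum, ← Finset.sum_add_distrib, ← sub_eq_zero,
    ← Finset.sum_sub_distrib]
  -- The summands of the difference telescope.
  let g : ℕ → W := fun k => -(((k : ℤ) * ((-1) ^ k * Ring.choose (-a - 1) k)) •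
    A (b - (-a - 1 - k)) (c + 1 - k))
  have key : ∀ k, g k - g (k + 1) = ((-1) ^ k * Ring.choose (-a - 1) k : ℤ) •
        ((b - (-a - 1 - k) + 1) • A (b - (-a - 1 - k) + 1) (c - k) +
          (c - k + 1) • A (b - (-a - 1 - k)) (c - k + 1)) -
      ((b + 1) • ((-1) ^ k * Ring.choose (-a - 1) k : ℤ) • A (b + 1 - (-a - 1 - k)) (c - k) +
        (c + 1) • ((-1) ^ k * Ring.choose (-a - 1) k : ℤ) •
          A (b - (-a - 1 - k)) (c + 1 - k)) := by
    intro k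
    simp only [g]
    push_cast
    rw [show b - (-a - 1 - ((k : ℤ) + 1)) = b + 1 - (-a - 1 - k) by ring,
      show b - (-a - 1 - (k : ℤ)) + 1 = b + 1 - (-a - 1 - k) by ring,
      show c + 1 - ((k : ℤ) + 1) = c - k by ring, show c - (k : ℤ) + 1 = c + 1 - k by ring,
      pow_succ]
    have e := succ_mul_ringChoose_succ (-a - 1) k
    linear_combination (norm := module) -((-1) ^ k * e) • A (b + 1 - (-a - 1 - k)) (c - k)
  rw [← Finset.sum_congr rfl fun k _ => key k, Finset.sum_range_sub']
  simp only [g]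
  rw [hc₀ (b - (-a - 1 - N)) (c + 1 - N) (by omega)]
  simp

theorem deltaMul₂₁_translation {A : ℤ → ℤ → W} (hA : IsTruncatedLeft A)
    (hA' : IsTruncatedLeft (fun b c => (b + 1) • A (b + 1) c + (c + 1) • A b (c + 1)))
    (a b c : ℤ) :
    deltaMul₂₁ (fun b c => (b + 1) • A (b + 1) c + (c + 1) • A b (c + 1)) a b c =
      (b + 1) • deltaMul₂₁ A a (b + 1) c + (c + 1) • deltaMul₂₁ A a b (c + 1) := by
  simp only [deltaMul₂₁_eq hA, deltaMul₂₁_eq hA']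
  have h := hA'.swap
  simp only [add_comm ((_ + 1 : ℤ) • A (_ + 1) _)] at h ⊢
  rw [deltaMul₁₂_translation hA.swap h]
  module

theorem deltaMul₁₀_translation {E : ℤ → ℤ → W} (hE : IsTruncatedLeft E)
    (hE' : IsTruncatedLeft (fun a c => (c + 1) • E a (c + 1))) (a b c : ℤ) :
    deltaMul₁₀ (fun a c => (c + 1) • E a (c + 1)) a b c =
      (b + 1) • deltaMul₁₀ E a (b + 1) c + (c + 1) • deltaMul₁₀ E a b (c + 1) := by
  obtain ⟨N, h₁, h₂, h₃⟩ := ((eventually_deltaMul₁₀_eq hE' a b c).and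
    ((eventually_deltaMul₁₀_eq hE a (b + 1) c).and
    (eventually_deltaMul₁₀_eq hE a b (c + 1)))).exists
  rw [h₁, h₂, h₃, Finset.smul_sum, Finset.smul_sum, ← Finset.sum_add_distrib]
  refine Finset.sum_congr rfl fun k _ => ?_
  rw [show c + (b + 1 + (k : ℤ)) + 1 = c + (b + k) + 1 + 1 by ring,
    show c + 1 + (b + (k : ℤ)) + 1 = c + (b + k) + 1 + 1 by ring,
    show b + 1 + (k : ℤ) = b + k + 1 by ring]
  have e : (b + 1) * Ring.choose (b + k + 1) k = (b + k + 1) * Ring.choose (b + k) k := by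
    cases k with
    | zero => simp
    | succ k =>
      have h := succ_mul_ringChoose_succ (b + ((k + 1 : ℕ) : ℤ)) k
      rw [Ring.choose_succ_succ]
      push_cast at h ⊢
      linear_combination -h
  linear_combination (norm := module) -((-1) ^ k * e) • E (a - k) (c + (b + k) + 1 + 1)

/-! #### The total degree -/

theorem deltaMul₁₂_degree {A : ℤ → ℤ → W} (hA : IsTruncatedRight A)
    (hA' : IsTruncatedRight (fun b c => (b + c) • A b c)) (a b c : ℤ) :
    deltaMul₁₂ (fun b c => (b + c) • A b c) a b c = (a + b + c + 1) • deltaMul₁₂ A a b c := by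
  obtain ⟨N, h₁, h₂⟩ := ((eventually_deltaMul₁₂_eq hA' a b c).and
    (eventually_deltaMul₁₂_eq hA a b c)).exists
  rw [h₁, h₂, Finset.smul_sum]
  refine Finset.sum_congr rfl fun k _ => ?_
  module

theorem deltaMul₂₁_degree {A : ℤ → ℤ → W} (hA : IsTruncatedLeft A)
    (hA' : IsTruncatedLeft (fun b c => (b + c) • A b c)) (a b c : ℤ) :
    deltaMul₂₁ (fun b c => (b + c) • A b c) a b c = (a + b + c + 1) • deltaMul₂₁ A a b c := by
  simp only [deltaMul₂₁_eq hA, deltaMul₂₁_eq hA']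
  have h : (fun c b => (b + c) • A b c) = fun c b : ℤ => (c + b) • A b c := by
    funext c b
    rw [add_comm]
  rw [h, deltaMul₁₂_degree hA.swap (h ▸ hA'.swap), smul_comm, add_right_comm a]

theorem deltaMul₁₀_degree {E : ℤ → ℤ → W} (hE : IsTruncatedLeft E)
    (hE' : IsTruncatedLeft (fun a c => (a + c) • E a c)) (a b c : ℤ) :
    deltaMul₁₀ (fun a c => (a + c) • E a c) a b c = (a + b + c + 1) • deltaMul₁₀ E a b c := by
  obtain ⟨N, h₁, h₂⟩ := ((eventually_deltaMul₁₀_eq hE' a b c).and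
    (eventually_deltaMul₁₀_eq hE a b c)).exists
  rw [h₁, h₂, Finset.smul_sum]
  refine Finset.sum_congr rfl fun k _ => ?_
  module

end DeltaProducts

/-! ### Annihilators of a family under commuting operators -/

section Annihilators

open Polynomial

/-- A set of polynomials that is stable under differentiation and contains a nonzero polynomial
contains a nonzero constant. -/
theorem exists_C_of_derivative_closed {R : Type*} [CommRing R] [IsDomain R] [CharZero R]
    {P : R[X] → Prop} (hP : ∀ q, P q → P (derivative q)) {q : R[X]} (hq : q ≠ 0) (h : P q) :
    ∃ a : R, a ≠ 0 ∧ P (C a) := by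
  induction hn : q.natDegree using Nat.strong_induction_on generalizing q with
  | _ n ih =>
    by_cases h0 : q.natDegree = 0
    · obtain ⟨a, rfl⟩ := natDegree_eq_zero.1 h0
      exact ⟨a, fun h => hq (by rw [h, C_0]), h⟩
    · exact ih _ (hn ▸ natDegree_derivative_lt h0) (fun h => h0 (derivative_eq_zero.1 h))
        (hP q h) rfl

/-- If `d` commutes with the constants and `[d, X] = g`, then `[d, p] = p' g`. -/
theorem commutator_eq_derivative_mul {R S : Type*} [CommRing R] [Ring S] (f : R[X] →+* S) (d : S)
    (hC : ∀ a, d * f (C a) = f (C a) * d) (g : R[X]) (hX : d * f X = f X * d + f g) (p : R[X]) :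
    d * f p = f p * d + f (derivative p * g) := by
  induction p using Polynomial.induction_on' with
  | add p q hp hq => simp only [map_add, mul_add, add_mul, hp, hq]; abel
  | monomial n a =>
    induction n with
    | zero => simp [hC]
    | succ n ih =>
      rw [← monomial_mul_X, map_mul, ← mul_assoc, ih, add_mul, mul_assoc, hX, derivative_mul,
        derivative_X, mul_one, add_mul, map_add, mul_add, mul_assoc, ← map_mul, ← map_mul,
        mul_right_comm, add_assoc, add_comm (f _) (f _)]

/-- The ideal of all elements of `R` that kill the family `J`, where `R` acts through `φ`. -/
def familyAnnihilator {R E ι : Type*} [CommRing R] [Algebra ℂ R] [AddCommGroup E] [Module ℂ E]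
    (φ : R →ₐ[ℂ] Module.End ℂ E) (J : ι → E) : Ideal R where
  carrier := {r | ∀ i, φ r (J i) = 0}
  zero_mem' i := by simp
  add_mem' hr hs i := by simp [hr i, hs i]
  smul_mem' s r hr i := by simp [hr i]

/-- A family `J` that satisfies `x₀ J = (x₁ - x₂) J` and whose annihilator is stable under a
translation operator and an Euler operator vanishes as soon as a nonzero polynomial in `x₁` and
`x₂` kills it.  In the coordinates `x₀ = x₁ - x₂` and `x₂`, the translation operator makes the
annihilator stable under `∂ / ∂x₂`, and the Euler operator then makes its part in `ℂ[x₀]` stable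
under `d / dx₀`, because `x₀` is a unit. -/
theorem family_eq_zero_of_polynomial_annihilates {R E ι : Type*} [CommRing R] [Algebra ℂ R]
    [AddCommGroup E] [Module ℂ E] (φ : R →ₐ[ℂ] Module.End ℂ E) (J : ι → E) {x₀ x₁ x₂ : R}
    (hx₀ : IsUnit x₀) (hJ : x₁ - (x₀ + x₂) ∈ familyAnnihilator φ J) (τ ε : Module.End ℂ E)
    (hτ : ∀ r ∈ familyAnnihilator φ J, ∀ i, φ r (τ (J i)) = 0)
    (hε : ∀ r ∈ familyAnnihilator φ J, ∀ i, φ r (ε (J i)) = 0)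
    (hτ₀ : τ * φ x₀ = φ x₀ * τ) (hτ₂ : τ * φ x₂ = φ x₂ * τ + 1)
    (hε₀ : ε * φ x₀ = φ x₀ * ε + φ x₀) {f : MvPolynomial (Fin 2) ℂ} (hf : f ≠ 0)
    (hfJ : MvPolynomial.aeval ![x₁, x₂] f ∈ familyAnnihilator φ J) (i : ι) : J i = 0 := by
  set I := familyAnnihilator φ J with hI
  let ev₀ : ℂ[X] →+* R := (aeval x₀ : ℂ[X] →ₐ[ℂ] R)
  let ev : ℂ[X][X] →+* R := eval₂RingHom ev₀ x₂
  -- The change of coordinates, and its inverse.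
  let Θ : MvPolynomial (Fin 2) ℂ →+* ℂ[X][X] :=
    MvPolynomial.eval₂Hom (C.comp C) ![C X + X, X]
  let Ψ : ℂ[X][X] →+* MvPolynomial (Fin 2) ℂ :=
    eval₂RingHom (aeval (MvPolynomial.X 0 - MvPolynomial.X 1) :
      ℂ[X] →ₐ[ℂ] MvPolynomial (Fin 2) ℂ) (MvPolynomial.X 1)
  have hΨΘ : Ψ.comp Θ = RingHom.id _ := by
    refine MvPolynomial.ringHom_ext (fun r => ?_) fun j => ?_
    · simp [Ψ, Θ, MvPolynomial.algebraMap_eq]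
    · fin_cases j <;> simp [Ψ, Θ]
  have hΘ : Θ f ≠ 0 := fun h => hf <| by
    rw [← RingHom.id_apply f, ← hΨΘ, RingHom.comp_apply, h, map_zero]
  have hΘI : ev (Θ f) ∈ I := by
    rw [← Ideal.Quotient.eq_zero_iff_mem] at hfJ ⊢
    rw [← hfJ]
    have : ((Ideal.Quotient.mk I).comp ev).comp Θ =
        (Ideal.Quotient.mk I).comp (MvPolynomial.aeval ![x₁, x₂] :
          MvPolynomial (Fin 2) ℂ →ₐ[ℂ] R) := by
      refine MvPolynomial.ringHom_ext (fun r => ?_) fun j => ?_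
      · simp [ev, ev₀, Θ]
      · fin_cases j
        · simpa [ev, ev₀, Θ] using (Ideal.Quotient.eq.2 hJ).symm
        · simp [ev, ev₀, Θ]
    exact congrArg (fun g : MvPolynomial (Fin 2) ℂ →+* R ⧸ I => g f) this
  have hφ₀ : ∀ p : ℂ[X], τ * φ (ev₀ p) = φ (ev₀ p) * τ := fun p => by
    have := commutator_eq_derivative_mul ((φ : R →+* Module.End ℂ E).comp ev₀) τ
      (fun a => by simp [ev₀, Algebra.commutes]) 0 (by simp [ev₀, hτ₀]) p
    simpa using this
  obtain ⟨p, hp, hpI⟩ := exists_C_of_derivative_closed (P := fun q => ev q ∈ I) (fun q hq j => by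
    have := commutator_eq_derivative_mul ((φ : R →+* Module.End ℂ E).comp ev) τ
      (fun a => by simpa [ev] using hφ₀ a) 1 (by simp [ev, hτ₂]) q
    have h := LinearMap.congr_fun this (J j)
    simpa [hτ _ hq j, hq j] using h.symm) hΘ hΘI
  have hpI : ev₀ p ∈ I := by simpa [ev] using hpI
  obtain ⟨a, ha, haI⟩ := exists_C_of_derivative_closed (P := fun q => ev₀ q ∈ I) (fun q hq => by
    have h : ev₀ (derivative q * X) ∈ I := fun j => by
      have := commutator_eq_derivative_mul ((φ : R →+* Module.End ℂ E).comp ev₀) ε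
        (fun a => by simp [ev₀, Algebra.commutes]) X (by simp [ev₀, hε₀]) q
      have h := LinearMap.congr_fun this (J j)
      simpa [hε _ hq j, hq j] using h.symm
    rw [map_mul, mul_comm] at h
    exact (Ideal.unit_mul_mem_iff_mem I (by simpa [ev₀] using hx₀)).1 h) hp hpI
  have h := haI i
  simpa [ev₀, ha] using h

end Annihilators

/-! ### The shift operators on triple series -/

section Shifts

variable {W : Type*} [AddCommGroup W] [Module ℂ W]

/-- The action of Laurent polynomials in `x₀, x₁, x₂` on formal series in these variables. -/
noncomputable def laurentAction (W : Type*) [AddCommGroup W] [Module ℂ W] :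
    AddMonoidAlgebra ℂ (ℤ × ℤ × ℤ) →ₐ[ℂ] Module.End ℂ (ℤ → ℤ → ℤ → W) :=
  AddMonoidAlgebra.lift ℂ _ (ℤ × ℤ × ℤ)
    { toFun := fun p =>
        { toFun := fun D a b c =>
            D (a - p.toAdd.1) (b - p.toAdd.2.1) (c - p.toAdd.2.2)
          map_add' := fun _ _ => rfl
          map_smul' := fun _ _ => rfl }
      map_one' := by ext; simp
      map_mul' := fun p q => by
        ext D a b c
        simp [sub_sub] }

theorem laurentAction_single (p : ℤ × ℤ × ℤ) (r : ℂ) (D : ℤ → ℤ → ℤ → W) (a b c : ℤ) :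
    laurentAction W (AddMonoidAlgebra.single p r) D a b c =
      r • D (a - p.1) (b - p.2.1) (c - p.2.2) := by
  simp [laurentAction]

/-- The action of Laurent polynomials commutes with linear maps applied to the coefficients. -/
theorem laurentAction_map (ℓ : Module.End ℂ W) (r : AddMonoidAlgebra ℂ (ℤ × ℤ × ℤ))
    (D : ℤ → ℤ → ℤ → W) :
    laurentAction W r (fun a b c => ℓ (D a b c)) =
      fun a b c => ℓ (laurentAction W r D a b c) := by
  induction r using AddMonoidAlgebra.induction_linear with
  | zero => ext; simp
  | add r s hr hs => ext a b c; simp [hr, hs]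
  | single p r => ext a b c; simp [laurentAction_single]

/-- The translation operator `∂₁ + ∂₂` on formal series in `x₀, x₁, x₂`. -/
def translationOp (W : Type*) [AddCommGroup W] [Module ℂ W] :
    Module.End ℂ (ℤ → ℤ → ℤ → W) where
  toFun D a b c := (b + 1) • D a (b + 1) c + (c + 1) • D a b (c + 1)
  map_add' D D' := by ext; simp only [Pi.add_apply]; module
  map_smul' r D := by ext; simp only [Pi.smul_apply, RingHom.id_apply]; module

/-- The Euler operator `x₀ ∂₀ + x₁ ∂₁ + x₂ ∂₂` on formal series in `x₀, x₁, x₂`. -/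
def eulerOp (W : Type*) [AddCommGroup W] [Module ℂ W] :
    Module.End ℂ (ℤ → ℤ → ℤ → W) where
  toFun D a b c := (a + b + c) • D a b c
  map_add' D D' := by ext; simp only [Pi.add_apply]; module
  map_smul' r D := by ext; simp only [Pi.smul_apply, RingHom.id_apply]; module

theorem polyMul_eq_laurentAction (f : MvPolynomial (Fin 2) ℂ) (D : ℤ → ℤ → ℤ → W) :
    polyMul f D = laurentAction W (MvPolynomial.aeval
      ![AddMonoidAlgebra.single (0, 1, 0) 1, AddMonoidAlgebra.single (0, 0, 1) 1] f) D := by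
  ext a b c
  rw [MvPolynomial.aeval_def, MvPolynomial.eval₂_eq', map_sum, polyMul]
  simp only [LinearMap.sum_apply, Finset.sum_apply]
  refine Finset.sum_congr rfl fun m _ => ?_
  rw [Fin.prod_univ_two, ← Algebra.smul_def, map_smul]
  simp [AddMonoidAlgebra.single_pow, AddMonoidAlgebra.single_mul_single, laurentAction_single]

end Shifts

/-! ### A quasimodule satisfies the Jacobi identity -/

namespace MobiusVertexAlgebra

variable {V : Type*} [AddCommGroup V] [Module ℂ V] {A : MobiusVertexAlgebra V}

theorem L_one_mode {u : V} {h : ℤ} (hu : A.L 1 u = (h : ℂ) • u) (n : ℤ) (y : V) :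
    A.L 1 (A.mode u n y) = A.mode u n (A.L 1 y) + (h - n - 1) • A.mode u n y := by
  have h₁ := LinearMap.congr_fun (A.L_mode 1 u n) y
  have h₂ := LinearMap.congr_fun (A.derivative u (n + 1)) y
  simp [Fin.sum_univ_three, hu, Ring.lie_def] at h₁ h₂
  rw [sub_eq_iff_eq_add'] at h₁
  rw [h₁, ← h₂]
  module

namespace Quasimodule

variable {W : Type*} [AddCommGroup W] [Module ℂ W] (M : A.Quasimodule W)

theorem L_zero_mode (u : V) (n : ℤ) (y : W) :
    M.L 0 (M.mode u n y) = M.mode u n (M.L 0 y) + (-n) • M.mode u (n - 1) y := by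
  have h₁ := LinearMap.congr_fun (M.L_mode 0 u n) y
  have h₂ := LinearMap.congr_fun (M.derivative u n) y
  simp [Fin.sum_univ_three, Ring.lie_def] at h₁ h₂
  rw [sub_eq_iff_eq_add'] at h₁
  rw [h₁, ← h₂]
  module

theorem L_one_mode {u : V} {h : ℤ} (hu : A.L 1 u = (h : ℂ) • u) (n : ℤ) (y : W) :
    M.L 1 (M.mode u n y) = M.mode u n (M.L 1 y) + (h - n - 1) • M.mode u n y := by
  have h₁ := LinearMap.congr_fun (M.L_mode 1 u n) y
  have h₂ := LinearMap.congr_fun (M.derivative u (n + 1)) y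
  simp [Fin.sum_univ_three, hu, Ring.lie_def] at h₁ h₂
  rw [sub_eq_iff_eq_add'] at h₁
  rw [h₁, ← h₂]
  module

/-- The coefficients of `Y_W(u, x₁) Y_W(v, x₂) w`. -/
def productSeries (u v : V) (w : W) (b c : ℤ) : W := M.mode u (-b - 1) (M.mode v (-c - 1) w)

/-- The coefficients of `Y_W(v, x₂) Y_W(u, x₁) w`. -/
def oppositeSeries (u v : V) (w : W) (b c : ℤ) : W := M.mode v (-c - 1) (M.mode u (-b - 1) w)

/-- The coefficients of `Y_W(Y(u, x₀) v, x₂) w`. -/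
def iterateSeries (u v : V) (w : W) (a c : ℤ) : W := M.mode (A.mode u (-a - 1) v) (-c - 1) w

theorem isTruncatedRight_productSeries (u v : V) (w : W) :
    IsTruncatedRight (M.productSeries u v w) := by
  obtain ⟨N, hN⟩ := M.truncation v w
  exact ⟨-N, fun b c hc => by rw [productSeries, hN _ (by omega), map_zero]⟩

theorem isTruncatedLeft_oppositeSeries (u v : V) (w : W) :
    IsTruncatedLeft (M.oppositeSeries u v w) := by
  obtain ⟨N, hN⟩ := M.truncation u w
  exact ⟨-N, fun b c hc => by rw [oppositeSeries, hN _ (by omega), map_zero]⟩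

theorem isTruncatedLeft_iterateSeries (u v : V) (w : W) :
    IsTruncatedLeft (M.iterateSeries u v w) := by
  obtain ⟨N, hN⟩ := A.truncation u v
  exact ⟨-N, fun b c hc => by simp [iterateSeries, hN (-b - 1) (by omega)]⟩

/-- The difference of the two sides of the Jacobi identity, applied to `w`. -/
noncomputable def jacobiDefect (u v : V) (w : W) : ℤ → ℤ → ℤ → W :=
  deltaMul₁₂ (M.productSeries u v w) - deltaMul₂₁ (M.oppositeSeries u v w)
    - deltaMul₁₀ (M.iterateSeries u v w)

theorem exists_polyMul_jacobiDefect (u v : V) :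
    ∃ f : MvPolynomial (Fin 2) ℂ, f ≠ 0 ∧ ∀ w : W, polyMul f (M.jacobiDefect u v w) = 0 := by
  obtain ⟨f, hf, h⟩ := M.quasiJacobi u v
  refine ⟨f, hf, fun w => ?_⟩
  have h := h w
  simp only [polyMul_eq_laurentAction] at h ⊢
  rw [jacobiDefect, map_sub, map_sub, sub_eq_zero]
  exact h

theorem jacobiDefect_sub_one (u v : V) (w : W) (a b c : ℤ) :
    M.jacobiDefect u v w (a - 1) b c =
      M.jacobiDefect u v w a (b - 1) c - M.jacobiDefect u v w a b (c - 1) := by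
  simp only [jacobiDefect, Pi.sub_apply,
    deltaMul₁₂_sub_one (M.isTruncatedRight_productSeries u v w),
    deltaMul₂₁_sub_one (M.isTruncatedLeft_oppositeSeries u v w),
    deltaMul₁₀_sub_one (M.isTruncatedLeft_iterateSeries u v w)]
  abel

theorem L_zero_jacobiDefect (u v : V) (w : W) (a b c : ℤ) :
    M.L 0 (M.jacobiDefect u v w a b c) =
      M.jacobiDefect u v (M.L 0 w) a b c + translationOp W (M.jacobiDefect u v w) a b c := by
  have hp := M.isTruncatedRight_productSeries u v w
  have ho := M.isTruncatedLeft_oppositeSeries u v w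
  have hi := M.isTruncatedLeft_iterateSeries u v w
  have hp' : IsTruncatedRight (fun b c => (b + 1) • M.productSeries u v w (b + 1) c +
      (c + 1) • M.productSeries u v w b (c + 1)) := by
    obtain ⟨N, hN⟩ := hp
    exact ⟨N - 1, fun b c hc => by simp [hN _ c (by omega), hN _ (c + 1) (by omega)]⟩
  have ho' : IsTruncatedLeft (fun b c => (b + 1) • M.oppositeSeries u v w (b + 1) c +
      (c + 1) • M.oppositeSeries u v w b (c + 1)) := by
    obtain ⟨N, hN⟩ := ho
    exact ⟨N - 1, fun b c hb => by simp [hN b _ (by omega), hN (b + 1) _ (by omega)]⟩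
  have hi' : IsTruncatedLeft (fun a c => (c + 1) • M.iterateSeries u v w a (c + 1)) := by
    obtain ⟨N, hN⟩ := hi
    exact ⟨N, fun b c hb => by simp [hN b _ hb]⟩
  simp only [jacobiDefect, Pi.sub_apply, map_sub, translationOp, LinearMap.coe_mk, AddHom.coe_mk]
  rw [deltaMul₁₂_map hp (M.isTruncatedRight_productSeries u v (M.L 0 w)) hp' (M.L 0) fun b c => by
      simp only [productSeries, L_zero_mode, map_add, map_zsmul]
      rw [show -(b + 1) - 1 = -b - 1 - 1 by ring, show -(c + 1) - 1 = -c - 1 - 1 by ring]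
      module,
    deltaMul₂₁_map ho (M.isTruncatedLeft_oppositeSeries u v (M.L 0 w)) ho' (M.L 0) fun b c => by
      simp only [oppositeSeries, L_zero_mode, map_add, map_zsmul]
      rw [show -(b + 1) - 1 = -b - 1 - 1 by ring, show -(c + 1) - 1 = -c - 1 - 1 by ring]
      module,
    deltaMul₁₀_map hi (M.isTruncatedLeft_iterateSeries u v (M.L 0 w)) hi' (M.L 0) fun b c => by
      simp only [iterateSeries, L_zero_mode]
      rw [show -(c + 1) - 1 = -c - 1 - 1 by ring]
      module,
    deltaMul₁₂_translation hp hp', deltaMul₂₁_translation ho ho', deltaMul₁₀_translation hi hi']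
  module

theorem L_one_jacobiDefect {u v : V} {h k : ℤ} (hu : A.L 1 u = (h : ℂ) • u)
    (hv : A.L 1 v = (k : ℂ) • v) (w : W) (a b c : ℤ) :
    M.L 1 (M.jacobiDefect u v w a b c) =
      M.jacobiDefect u v (M.L 1 w + (h + k) • w) a b c + M.jacobiDefect u v w a b c +
        eulerOp W (M.jacobiDefect u v w) a b c := by
  have hp := M.isTruncatedRight_productSeries u v w
  have ho := M.isTruncatedLeft_oppositeSeries u v w
  have hi := M.isTruncatedLeft_iterateSeries u v w
  have hp' : IsTruncatedRight (fun b c => (b + c) • M.productSeries u v w b c) := by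
    obtain ⟨N, hN⟩ := hp
    exact ⟨N, fun b c hc => by simp [hN _ c hc]⟩
  have ho' : IsTruncatedLeft (fun b c => (b + c) • M.oppositeSeries u v w b c) := by
    obtain ⟨N, hN⟩ := ho
    exact ⟨N, fun b c hb => by simp [hN b _ hb]⟩
  have hi' : IsTruncatedLeft (fun a c => (a + c) • M.iterateSeries u v w a c) := by
    obtain ⟨N, hN⟩ := hi
    exact ⟨N, fun b c hb => by simp [hN b _ hb]⟩
  simp only [jacobiDefect, Pi.sub_apply, map_sub, eulerOp, LinearMap.coe_mk, AddHom.coe_mk]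
  rw [deltaMul₁₂_map hp (M.isTruncatedRight_productSeries u v (M.L 1 w + (h + k) • w)) hp'
      (M.L 1) fun b c => by
        simp only [productSeries, M.L_one_mode hu, M.L_one_mode hv, map_add, map_zsmul]
        module,
    deltaMul₂₁_map ho (M.isTruncatedLeft_oppositeSeries u v (M.L 1 w + (h + k) • w)) ho'
      (M.L 1) fun b c => by
        simp only [oppositeSeries, M.L_one_mode hu, M.L_one_mode hv, map_add, map_zsmul]
        module,
    deltaMul₁₀_map hi (M.isTruncatedLeft_iterateSeries u v (M.L 1 w + (h + k) • w)) hi'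
      (M.L 1) fun a c => by
        have hm : A.L 1 (A.mode u (-a - 1) v) = ((h + k + a : ℤ) : ℂ) • A.mode u (-a - 1) v := by
          rw [MobiusVertexAlgebra.L_one_mode hu, hv, map_smul]
          push_cast
          module
        simp only [iterateSeries, M.L_one_mode hm, map_add, map_zsmul]
        module,
    deltaMul₁₂_degree hp hp', deltaMul₂₁_degree ho ho', deltaMul₁₀_degree hi hi']
  module

/-- The Jacobi identity holds without the polynomial factor: the representation of `sl(2)` forces
every quasimodule to be a module. -/
theorem jacobiDefect_eq_zero {u v : V} {h k : ℤ} (hu : A.L 1 u = (h : ℂ) • u)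
    (hv : A.L 1 v = (k : ℂ) • v) (w : W) : M.jacobiDefect u v w = 0 := by
  obtain ⟨f, hf, hfJ⟩ := M.exists_polyMul_jacobiDefect u v
  refine family_eq_zero_of_polynomial_annihilates (laurentAction W) (M.jacobiDefect u v)
    (x₀ := AddMonoidAlgebra.single (1, 0, 0) 1) (x₁ := AddMonoidAlgebra.single (0, 1, 0) 1)
    (x₂ := AddMonoidAlgebra.single (0, 0, 1) 1) ?_ ?_ (translationOp W) (eulerOp W) ?_ ?_ ?_ ?_ ?_
    hf (fun w => by rw [← polyMul_eq_laurentAction, hfJ]) w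
  · refine IsUnit.of_mul_eq_one (AddMonoidAlgebra.single (-1, 0, 0) 1) ?_
    simp [AddMonoidAlgebra.single_mul_single, AddMonoidAlgebra.one_def]
    rfl
  · intro w
    ext a b c
    simp [laurentAction_single, M.jacobiDefect_sub_one]
  · intro r hr w
    have e : translationOp W (M.jacobiDefect u v w) =
        (fun a b c => M.L 0 (M.jacobiDefect u v w a b c)) - M.jacobiDefect u v (M.L 0 w) := by
      ext a b c
      simp [M.L_zero_jacobiDefect]
    rw [e, map_sub, laurentAction_map, hr, hr]
    ext
    simp
  · intro r hr w
    have e : eulerOp W (M.jacobiDefect u v w) =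
        (fun a b c => M.L 1 (M.jacobiDefect u v w a b c)) -
          M.jacobiDefect u v (M.L 1 w + (h + k) • w) - M.jacobiDefect u v w := by
      ext a b c
      simp only [M.L_one_jacobiDefect hu hv, Pi.sub_apply]
      abel
    rw [e, map_sub, map_sub, laurentAction_map, hr, hr]
    ext
    simp
  · ext D a b c
    simp [translationOp, laurentAction_single]
  · ext D a b c
    simp only [translationOp, Module.End.mul_apply, LinearMap.coe_mk, AddHom.coe_mk,
      laurentAction_single, LinearMap.add_apply, Module.End.one_apply, Pi.add_apply, sub_zero,
      one_smul, add_sub_cancel_right, sub_add_cancel]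
    module
  · ext D a b c
    simp only [eulerOp, Module.End.mul_apply, LinearMap.coe_mk, AddHom.coe_mk,
      laurentAction_single, LinearMap.add_apply, Pi.add_apply, sub_zero, one_smul]
    module

/-! ### Commutators and iterates -/

theorem deltaMul₁₂_sub_deltaMul₂₁ {u v : V} {h k : ℤ} (hu : A.L 1 u = (h : ℂ) • u)
    (hv : A.L 1 v = (k : ℂ) • v) (w : W) (a b c : ℤ) :
    deltaMul₁₂ (M.productSeries u v w) a b c - deltaMul₂₁ (M.oppositeSeries u v w) a b c =
      deltaMul₁₀ (M.iterateSeries u v w) a b c :=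
  sub_eq_zero.1 (congrFun (congrFun (congrFun (M.jacobiDefect_eq_zero hu hv w) a) b) c)

/-- The commutator `[u_m, v_n]` is a combination of the modes `(u_i v)_{m + n - i}`, `i ≥ 0`. -/
theorem commutator_mem {u v : V} {h k : ℤ} (hu : A.L 1 u = (h : ℂ) • u)
    (hv : A.L 1 v = (k : ℂ) • v) (w : W) (m n : ℤ) {S : Submodule ℂ W}
    (hS : ∀ i : ℕ, M.mode (A.mode u i v) (m + n - i) w ∈ S) :
    M.mode u m (M.mode v n w) - M.mode v n (M.mode u m w) ∈ S := by
  have hJ := M.deltaMul₁₂_sub_deltaMul₂₁ hu hv w (-1) (-m - 1) (-n - 1)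
  have h₁ : deltaMul₁₂ (M.productSeries u v w) (-1) (-m - 1) (-n - 1) =
      M.mode u m (M.mode v n w) := by
    rw [deltaMul₁₂, finsum_eq_single _ 0 fun k hk => ?_]
    · simp [productSeries]
    · simp [Ring.choose_zero_pos ℤ (Nat.pos_of_ne_zero hk)]
  have h₂ : deltaMul₂₁ (M.oppositeSeries u v w) (-1) (-m - 1) (-n - 1) =
      M.mode v n (M.mode u m w) := by
    rw [deltaMul₂₁, finsum_eq_single _ 0 fun k hk => ?_]
    · simp [oppositeSeries]
    · simp [Ring.choose_zero_pos ℤ (Nat.pos_of_ne_zero hk)]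
  rw [← h₁, ← h₂, hJ]
  refine finsum_induction (· ∈ S) S.zero_mem (fun _ _ => S.add_mem) fun i => ?_
  refine zsmul_mem ?_ _
  have := hS i
  rwa [iterateSeries, show -(-1 - (i : ℤ)) - 1 = i by ring,
    show -(-n - 1 + (-m - 1 + (i : ℤ)) + 1) - 1 = m + n - i by ring]

theorem iterateSeries_eq {u v : V} {h k : ℤ} (hu : A.L 1 u = (h : ℂ) • u)
    (hv : A.L 1 v = (k : ℂ) • v) (w : W) (a c : ℤ) :
    M.iterateSeries u v w a c = deltaMul₁₂ (M.productSeries u v w) a (-1) c -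
      deltaMul₂₁ (M.oppositeSeries u v w) a (-1) c := by
  rw [M.deltaMul₁₂_sub_deltaMul₂₁ hu hv, deltaMul₁₀, finsum_eq_single _ 0 fun i hi => ?_]
  · simp
  · obtain ⟨j, rfl⟩ := Nat.exists_eq_succ_of_ne_zero hi
    have : Ring.choose (-1 + ((j.succ : ℕ) : ℤ)) j.succ = 0 := by
      rw [show -1 + ((j.succ : ℕ) : ℤ) = (j : ℤ) by push_cast; ring, Ring.choose_natCast,
        Nat.choose_succ_self, Nat.cast_zero]
    rw [this, mul_zero, zero_smul]

/-- The mode `(u_m v)_n` is an infinite, on each vector finite, combination of products `u_p v_q`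
and `v_q u_p`. -/
theorem mode_mode_mem {u v : V} {h k : ℤ} (hu : A.L 1 u = (h : ℂ) • u)
    (hv : A.L 1 v = (k : ℂ) • v) (w : W) (m n : ℤ) {S : Submodule ℂ W}
    (h₁ : ∀ p q, M.mode u p (M.mode v q w) ∈ S) (h₂ : ∀ p q, M.mode v q (M.mode u p w) ∈ S) :
    M.mode (A.mode u m v) n w ∈ S := by
  have h := M.iterateSeries_eq hu hv w (-m - 1) (-n - 1)
  simp only [iterateSeries, neg_sub, sub_neg_eq_add, add_sub_cancel_left] at h
  rw [h]
  refine S.sub_mem ?_ ?_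
  · exact finsum_induction (· ∈ S) S.zero_mem (fun _ _ => S.add_mem)
      fun i => zsmul_mem (h₁ _ _) _
  · exact finsum_induction (· ∈ S) S.zero_mem (fun _ _ => S.add_mem)
      fun i => zsmul_mem (h₂ _ _) _

/-- The mode `(u_{-1} v)_{2n+1}` is `u_n v_n`, up to products `u_p v_q` and `v_q u_p` with
`p + q = 2n` and `p ≠ n`, and up to the commutator of `u_n` and `v_n`. -/
theorem mode_neg_one_mode_sub_mem {u v : V} {h k : ℤ} (hu : A.L 1 u = (h : ℂ) • u)
    (hv : A.L 1 v = (k : ℂ) • v) (w : W) (n : ℤ) {S : Submodule ℂ W}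
    (h₁ : ∀ p q, p + q = 2 * n → p ≠ n → M.mode u p (M.mode v q w) ∈ S)
    (h₂ : ∀ p q, p + q = 2 * n → p ≠ n → M.mode v q (M.mode u p w) ∈ S)
    (h₃ : M.mode u n (M.mode v n w) - M.mode v n (M.mode u n w) ∈ S) :
    M.mode (A.mode u (-1) v) (2 * n + 1) w - M.mode u n (M.mode v n w) ∈ S := by
  have h := M.iterateSeries_eq hu hv w 0 (-(2 * n + 1) - 1)
  obtain ⟨N, e₁, e₂, hN⟩ := ((eventually_deltaMul₁₂_eq (M.isTruncatedRight_productSeries u v w)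
    0 (-1) (-(2 * n + 1) - 1)).and ((eventually_deltaMul₁₂_eq
    (M.isTruncatedLeft_oppositeSeries u v w).swap 0 (-(2 * n + 1) - 1) (-1)).and
    (Filter.eventually_gt_atTop n.natAbs))).exists
  rw [deltaMul₂₁_eq (M.isTruncatedLeft_oppositeSeries u v w), e₁, e₂] at h
  simp only [neg_zero, zero_sub, ringChoose_neg_one, ← mul_pow, neg_mul_neg, one_mul, one_pow,
    one_smul, iterateSeries, productSeries, oppositeSeries] at h
  have e : ((-1 : ℤ).negOnePow : ℤ) = -1 := by simp
  rw [e, neg_one_smul, sub_neg_eq_add, ← Finset.sum_add_distrib, neg_sub, sub_neg_eq_add,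
    add_sub_cancel_left] at h
  -- The `i`-th summand is `u_{-i-1} v_{2n+1+i} + v_{2n-i} u_i`, so the index `n` occurs in one
  -- summand only, and there in one of its two terms: the second one if `n ≥ 0`, the first one if `n < 0`.
  rw [h, ← Finset.add_sum_erase _ _ (a := if 0 ≤ n then n.toNat else (-1 - n).toNat)
    (Finset.mem_range.2 (by split_ifs <;> omega)), add_sub_right_comm]
  refine S.add_mem ?_ (S.sum_mem fun i hi => ?_)
  · split_ifs with hn
    · have e₃ : ((n.toNat : ℕ) : ℤ) = n := Int.toNat_of_nonneg hn
      rw [e₃, show -(-(2 * n + 1) - 1 - (-1 - n)) - 1 = n by ring,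
        show -(-1 - n) - 1 = n by ring, add_sub_assoc]
      refine S.add_mem (h₁ _ _ (by ring) (by omega)) ?_
      rw [← neg_sub]
      exact S.neg_mem h₃
    · have e₃ : (((-1 - n).toNat : ℕ) : ℤ) = -1 - n := Int.toNat_of_nonneg (by omega)
      rw [e₃, show -(-(2 * n + 1) - 1 - (-1 - n)) - 1 = n by ring,
        show -(-1 - (-1 - (-1 - n))) - 1 = n by ring, add_sub_cancel_left]
      exact h₂ _ _ (by ring) (by omega)
  · have hi := (Finset.mem_erase.1 hi).1
    refine S.add_mem (h₁ _ _ (by ring) ?_) (h₂ _ _ (by ring) ?_)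
    all_goals split_ifs at hi <;> omega

end Quasimodule

end MobiusVertexAlgebra

/-! ### Lists of indexed letters -/

theorem exists_perm_of_not_nodup {α : Type*} {l : List (α × ℤ)} (hl : ¬(l.map Prod.snd).Nodup) :
    ∃ (u v : α) (n : ℤ) (l' : List (α × ℤ)), l.Perm ((u, n) :: (v, n) :: l') := by
  classical
  induction l with
  | nil => simp at hl
  | cons p l ih =>
    rw [List.map_cons, List.nodup_cons, not_and_or, not_not] at hl
    rcases hl with hl | hl
    · obtain ⟨q, hq, hqp⟩ := List.mem_map.1 hl
      refine ⟨p.1, q.1, p.2, l.erase q, .cons _ ?_⟩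
      rw [← hqp]
      exact List.perm_cons_erase hq
    · obtain ⟨u, v, n, l', h⟩ := ih hl
      exact ⟨u, v, n, p :: l',
        ((h.cons p).trans (.swap _ _ _)).trans ((List.Perm.swap _ _ _).cons _)⟩

theorem exists_perm_pairwise_lt {α : Type*} {l : List (α × ℤ)} (hl : (l.map Prod.snd).Nodup) :
    ∃ l' : List (α × ℤ), l.Perm l' ∧ l'.Pairwise fun p q => p.2 < q.2 := by
  classical
  let r : α × ℤ → α × ℤ → Prop := fun p q => p.2 ≤ q.2
  have : Std.Total r := ⟨fun p q => le_total p.2 q.2⟩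
  have : IsTrans (α × ℤ) r := ⟨fun p q s => le_trans⟩
  have hp := List.perm_insertionSort r l
  refine ⟨l.insertionSort r, hp.symm, ?_⟩
  have hn : (l.insertionSort r).Pairwise fun p q => p.2 ≠ q.2 :=
    List.pairwise_map.1 ((hp.map Prod.snd).nodup_iff.2 hl)
  exact ((List.pairwise_insertionSort r l).and hn).imp fun h => lt_of_le_of_ne h.1 h.2

theorem sum_map_sq_le_sq_sum_map {ι : Type*} (d : ι → ℤ) {l : List ι} (hl : ∀ p ∈ l, 0 ≤ d p) :
    (l.map fun p => d p ^ 2).sum ≤ (l.map d).sum ^ 2 := by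
  induction l with
  | nil => simp
  | cons p l ih =>
    have h₁ := ih fun q hq => hl q (List.mem_cons_of_mem _ hq)
    have h₂ := hl p List.mem_cons_self
    have h₃ : 0 ≤ (l.map d).sum := List.sum_nonneg <| by
      simpa using fun q hq => hl q (List.mem_cons_of_mem _ hq)
    simp only [List.map_cons, List.sum_cons]
    nlinarith [mul_nonneg h₂ h₃]

/-! ### Homogeneous vectors and the quotient by `C₂(V)` -/

namespace MobiusVertexAlgebra

variable {V : Type*} [AddCommGroup V] [Module ℂ V] {A : MobiusVertexAlgebra V}

/-- A vector has a component in `V_k`, depending linearly on it. -/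
theorem exists_projection (A : MobiusVertexAlgebra V) (k : ℤ) : ∃ π : V →ₗ[ℂ] V,
    (∀ v ∈ A.grade k, π v = v) ∧ ∀ j ≠ k, ∀ v ∈ A.grade j, π v = 0 := by
  let _ := A.grade_internal.chooseDecomposition
  refine ⟨(A.grade k).subtype ∘ₗ DirectSum.component ℂ ℤ (fun i => A.grade i) k ∘ₗ
    (DirectSum.decomposeLinearEquiv A.grade).toLinearMap, fun v hv => ?_, fun j hj v hv => ?_⟩
  · exact DirectSum.decompose_of_mem_same A.grade hv
  · exact DirectSum.decompose_of_mem_ne A.grade hv hj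

@[elab_as_elim]
theorem homogeneous_induction {P : V → Prop} (v : V) (zero : P 0)
    (add : ∀ u v, P u → P v → P (u + v)) (homogeneous : ∀ k, ∀ v ∈ A.grade k, P v) : P v :=
  Submodule.iSup_induction A.grade (motive := P)
    (by rw [A.grade_internal.submodule_iSup_eq_top]; trivial) homogeneous zero add

theorem mem_grade_of_L_one {v : V} {n : ℤ} (hv : A.L 1 v = (n : ℂ) • v) : v ∈ A.grade n := by
  classical
  let _ := A.grade_internal.chooseDecomposition
  have key : ∀ (j : ℤ) (x : V), ((DirectSum.decompose A.grade (A.L 1 x) j : A.grade j) : V) =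
      (j : ℂ) • (DirectSum.decompose A.grade x j : V) := fun j x => by
    refine A.homogeneous_induction x (by simp) (fun u v hu hv => ?_) fun k v hv => ?_
    · simp [DirectSum.decompose_add, hu, hv]
    · rw [A.L_zero_grade k v hv, DirectSum.decompose_smul, DirectSum.smul_apply,
        Submodule.coe_smul]
      by_cases h : k = j
      · subst h
        simp [DirectSum.decompose_of_mem_same A.grade hv]
      · simp [DirectSum.decompose_of_mem_ne A.grade hv h]
  rw [← DirectSum.sum_support_decompose A.grade v]
  refine Submodule.sum_mem _ fun j _ => ?_
  by_cases h : j = n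
  · exact h ▸ SetLike.coe_mem _
  · have h₁ := key j v
    rw [hv] at h₁
    have h₂ : ((n : ℂ) - j) • (DirectSum.decompose A.grade v j : V) = 0 := by
      rw [sub_smul, ← h₁, DirectSum.decompose_smul, DirectSum.smul_apply, Submodule.coe_smul,
        sub_self]
    rw [smul_eq_zero, sub_eq_zero, Int.cast_inj] at h₂
    rw [h₂.resolve_left (Ne.symm h)]
    exact zero_mem _

theorem mode_mem_grade {u v : V} {h k : ℤ} (hu : u ∈ A.grade h) (hv : v ∈ A.grade k) (n : ℤ) :
    A.mode u n v ∈ A.grade (h + k - n - 1) := by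
  refine mem_grade_of_L_one ?_
  rw [MobiusVertexAlgebra.L_one_mode (A.L_zero_grade h u hu), A.L_zero_grade k v hv, map_smul]
  push_cast
  module

theorem IsNGraded.eq_zero_or_exists_nat (hA : A.IsNGraded) {v : V} {n : ℤ}
    (hv : v ∈ A.grade n) : v = 0 ∨ ∃ k : ℕ, (k : ℤ) = n := by
  rcases lt_or_ge n 0 with h | h
  · rw [hA n h, Submodule.mem_bot] at hv
    exact Or.inl hv
  · exact Or.inr ⟨n.toNat, Int.toNat_of_nonneg h⟩

theorem C₂_le_span_homogeneous (hA : A.IsNGraded) :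
    A.C₂ ≤ Submodule.span ℂ {y | ∃ (i j : ℕ) (a b : V), a ∈ A.grade i ∧ b ∈ A.grade j ∧
      y = A.mode a (-2) b} := by
  refine Submodule.span_le.2 ?_
  rintro _ ⟨u, v, rfl⟩
  rw [SetLike.mem_coe]
  refine A.homogeneous_induction u (by simp) (fun u u' hu hu' => ?_) fun i a ha => ?_
  · simpa using add_mem hu hu'
  refine A.homogeneous_induction v (by simp) (fun u u' hu hu' => ?_) fun j b hb => ?_
  · simpa using add_mem hu hu'
  obtain rfl | ⟨i, rfl⟩ := hA.eq_zero_or_exists_nat ha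
  · simp
  obtain rfl | ⟨j, rfl⟩ := hA.eq_zero_or_exists_nat hb
  · simp
  exact Submodule.subset_span ⟨i, j, a, b, ha, hb, rfl⟩

/-- A homogeneous vector of weight `k` is a combination of elements of `X` of weight `k` and of
vectors `a_{-2} b` with `a` and `b` homogeneous of weights that add up to `k - 1`. -/
theorem IsHomogeneousC₂Basis.grade_le {X : Set V} (hX : A.IsHomogeneousC₂Basis X)
    (hA : A.IsNGraded) (k : ℕ) :
    A.grade k ≤ Submodule.span ℂ ((X ∩ A.grade k) ∪ {y | ∃ (i j : ℕ) (a b : V), i + j + 1 = k ∧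
      a ∈ A.grade i ∧ b ∈ A.grade j ∧ y = A.mode a (-2) b}) := by
  set K := Submodule.span ℂ ((X ∩ A.grade k) ∪ {y | ∃ (i j : ℕ) (a b : V), i + j + 1 = k ∧
      a ∈ A.grade i ∧ b ∈ A.grade j ∧ y = A.mode a (-2) b}) with hK
  intro u hu
  obtain ⟨π, h₁, h₂⟩ := A.exists_projection k
  have htop : Submodule.span ℂ X ⊔ A.C₂ = ⊤ := by
    have := congrArg (Submodule.comap A.C₂.mkQ) hX.span_eq_top
    rwa [Submodule.span_image, Submodule.comap_map_eq, Submodule.ker_mkQ,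
      Submodule.comap_top] at this
  have hle : Submodule.span ℂ X ⊔ A.C₂ ≤ K.comap π := by
    refine sup_le (Submodule.span_le.2 fun x hx => ?_)
      ((C₂_le_span_homogeneous hA).trans (Submodule.span_le.2 ?_))
    · obtain ⟨n, hn⟩ := hX.homogeneous x hx
      rw [SetLike.mem_coe, Submodule.mem_comap]
      by_cases h : n = k
      · subst h
        rw [h₁ x hn]
        exact Submodule.subset_span (Or.inl ⟨hx, hn⟩)
      · rw [h₂ n h x hn]
        exact zero_mem _
    · rintro _ ⟨i, j, a, b, ha, hb, rfl⟩
      have hn := mode_mem_grade ha hb (-2)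
      rw [SetLike.mem_coe, Submodule.mem_comap]
      by_cases h : (i : ℤ) + j - -2 - 1 = k
      · rw [h₁ _ (h ▸ hn)]
        exact Submodule.subset_span (Or.inr ⟨i, j, a, b, by omega, ha, hb, rfl⟩)
      · rw [h₂ _ h _ hn]
        exact zero_mem _
  have : u ∈ K.comap π := hle (htop ▸ Submodule.mem_top)
  rwa [Submodule.mem_comap, h₁ u hu] at this

/-! ### The weight filtration -/

/-- `A.HasWeight l s` says that the letters of `l` are modes of homogeneous vectors whose weights
add up to `s`. -/
inductive HasWeight (A : MobiusVertexAlgebra V) : List (V × ℤ) → ℕ → Prop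
  | nil : HasWeight A [] 0
  | cons {p : V × ℤ} {l : List (V × ℤ)} {k s : ℕ} (hp : p.1 ∈ A.grade k) (hl : HasWeight A l s) :
      HasWeight A (p :: l) (s + k)

theorem HasWeight.perm {l l' : List (V × ℤ)} (h : l.Perm l') {s : ℕ} (hl : A.HasWeight l s) :
    A.HasWeight l' s := by
  induction h generalizing s with
  | nil => exact hl
  | cons p _ ih =>
    cases hl with
    | cons hp hl => exact .cons hp (ih hl)
  | swap p q l =>
    cases hl with
    | cons hp hl =>
      cases hl with
      | cons hq hl =>
        rw [add_right_comm]
        exact .cons hq (.cons hp hl)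
  | trans _ _ ih ih' => exact ih' (ih hl)

namespace Quasimodule

variable {W : Type*} [AddCommGroup W] [Module ℂ W] (M : A.Quasimodule W) (w : W)

/-- The span of all monomials in modes of homogeneous vectors, of total weight less than `s`. -/
def weightFiltration (s : ℕ) : Submodule ℂ W :=
  Submodule.span ℂ {y | ∃ l t, A.HasWeight l t ∧ t < s ∧ y = M.monomial l w}

variable {M w}

theorem weightFiltration_mono {s t : ℕ} (h : s ≤ t) :
    M.weightFiltration w s ≤ M.weightFiltration w t :=
  Submodule.span_mono fun _ ⟨l, r, hl, hr, hy⟩ => ⟨l, r, hl, hr.trans_le h, hy⟩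

theorem monomial_mem_weightFiltration {l : List (V × ℤ)} {s : ℕ} (hl : A.HasWeight l s) :
    M.monomial l w ∈ M.weightFiltration w (s + 1) :=
  Submodule.subset_span ⟨l, s, hl, s.lt_succ_self, rfl⟩

theorem mode_mem_weightFiltration {u : V} {k s : ℕ} (hu : u ∈ A.grade k) (n : ℤ) {y : W}
    (hy : y ∈ M.weightFiltration w s) : M.mode u n y ∈ M.weightFiltration w (s + k) := by
  induction hy using Submodule.span_induction with
  | mem y hy =>
    obtain ⟨l, t, hl, ht, rfl⟩ := hy
    exact Submodule.subset_span ⟨(u, n) :: l, t + k, .cons hu hl, by omega, rfl⟩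
  | zero => simp
  | add y z _ _ hy hz => rw [map_add]; exact add_mem hy hz
  | smul c y _ hy => rw [map_smul]; exact Submodule.smul_mem _ c hy

/-- Commutators lower the weight, since `u_i v` has weight less than `wt u + wt v` for `i ≥ 0`. -/
theorem commutator_mem_weightFiltration (hA : A.IsNGraded) {u v : V} {h k s : ℕ}
    (hu : u ∈ A.grade h) (hv : v ∈ A.grade k) (m n : ℤ) {y : W}
    (hy : y ∈ M.weightFiltration w (s + 1)) :
    M.mode u m (M.mode v n y) - M.mode v n (M.mode u m y) ∈
      M.weightFiltration w (s + k + h) := by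
  refine M.commutator_mem (A.L_zero_grade h u hu) (A.L_zero_grade k v hv) y m n fun i => ?_
  have hi := mode_mem_grade hu hv i
  obtain h0 | ⟨j, hj⟩ := hA.eq_zero_or_exists_nat hi
  · simp [h0]
  · rw [← hj] at hi
    exact weightFiltration_mono (by omega) (mode_mem_weightFiltration hi _ hy)

/-- The modes of `a_{-2} b`, which has weight `wt a + wt b + 1`, act as if the weight were one
less. -/
theorem mode_mode_neg_two_mem_weightFiltration {a b : V} {i j s : ℕ}
    (ha : a ∈ A.grade i) (hb : b ∈ A.grade j) (n : ℤ) {y : W}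
    (hy : y ∈ M.weightFiltration w (s + 1)) :
    M.mode (A.mode a (-2) b) n y ∈ M.weightFiltration w (s + (i + j + 1)) := by
  refine M.mode_mode_mem (A.L_zero_grade i a ha) (A.L_zero_grade j b hb) y _ n
    (fun p q => ?_) fun p q => ?_
  · exact weightFiltration_mono (by omega)
      (mode_mem_weightFiltration ha p (mode_mem_weightFiltration hb q hy))
  · exact weightFiltration_mono (by omega)
      (mode_mem_weightFiltration hb q (mode_mem_weightFiltration ha p hy))

/-- Modulo lower weight, the letters of a monomial commute. -/
theorem monomial_sub_monomial_mem (hA : A.IsNGraded) {l l' : List (V × ℤ)} (h : l.Perm l')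
    {s : ℕ} (hl : A.HasWeight l s) :
    M.monomial l w - M.monomial l' w ∈ M.weightFiltration w s := by
  induction h generalizing s with
  | nil => simp
  | cons p _ ih =>
    cases hl with
    | cons hp hl =>
      have := mode_mem_weightFiltration hp p.2 (ih hl)
      rwa [map_sub] at this
  | swap p q l =>
    cases hl with
    | cons hp hl =>
      cases hl with
      | cons hq hl =>
        exact commutator_mem_weightFiltration hA hp hq _ _ (monomial_mem_weightFiltration hl)
  | trans h _ ih ih' =>
    have := add_mem (ih hl) (ih' (hl.perm h))
    rwa [sub_add_sub_cancel] at this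

/-- Modulo lower weight, a mode of a homogeneous vector is a combination of modes of elements
of `X` of the same weight. -/
theorem mode_mem_of_forall_mem {X : Set V} (hX : A.IsHomogeneousC₂Basis X) (hA : A.IsNGraded)
    {u : V} {k s : ℕ} (hu : u ∈ A.grade k) (n : ℤ) {y : W}
    (hy : y ∈ M.weightFiltration w (s + 1)) {S : Submodule ℂ W}
    (hS : M.weightFiltration w (s + k) ≤ S)
    (hXS : ∀ x ∈ X, x ∈ A.grade k → M.mode x n y ∈ S) : M.mode u n y ∈ S := by
  have h := hX.grade_le hA k hu
  clear hu
  induction h using Submodule.span_induction with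
  | mem u hu =>
    rcases hu with ⟨hx, hk⟩ | ⟨i, j, a, b, rfl, ha, hb, rfl⟩
    · exact hXS u hx hk
    · exact hS (mode_mode_neg_two_mem_weightFiltration ha hb n hy)
  | zero => simp
  | add u v _ _ hu hv => simpa using add_mem hu hv
  | smul c u _ hu => simpa using S.smul_mem c hu

/-- Monomials of weight `s` are combinations of monomials in `X` of weight `s`, modulo lower
weight. -/
theorem monomial_mem_span_sup {X : Set V} (hX : A.IsHomogeneousC₂Basis X) (hA : A.IsNGraded)
    {l : List (V × ℤ)} {s : ℕ} (hl : A.HasWeight l s) :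
    M.monomial l w ∈ Submodule.span ℂ {y | ∃ l, A.HasWeight l s ∧ (∀ p ∈ l, p.1 ∈ X) ∧
      y = M.monomial l w} ⊔ M.weightFiltration w s := by
  induction hl with
  | nil =>
    exact Submodule.mem_sup_left (Submodule.subset_span ⟨[], .nil, by simp, rfl⟩)
  | @cons p l k s hp hl ih =>
    have hle : Submodule.span ℂ {y | ∃ l, A.HasWeight l s ∧ (∀ p ∈ l, p.1 ∈ X) ∧
        y = M.monomial l w} ⊔ M.weightFiltration w s ≤
        (Submodule.span ℂ {y | ∃ l, A.HasWeight l (s + k) ∧ (∀ p ∈ l, p.1 ∈ X) ∧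
          y = M.monomial l w} ⊔ M.weightFiltration w (s + k)).comap (M.mode p.1 p.2) := by
      refine sup_le (Submodule.span_le.2 ?_) fun y hy =>
        Submodule.mem_sup_right (mode_mem_weightFiltration hp _ hy)
      rintro _ ⟨l', hl', hXl, rfl⟩
      rw [SetLike.mem_coe, Submodule.mem_comap]
      refine mode_mem_of_forall_mem hX hA hp p.2 (monomial_mem_weightFiltration hl') le_sup_right
        fun x hx hk => ?_
      exact Submodule.mem_sup_left (Submodule.subset_span
        ⟨(x, p.2) :: l', .cons hk hl', List.forall_mem_cons.2 ⟨hx, hXl⟩, rfl⟩)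
    exact hle ih

/-! ### Removing repeated indices -/

theorem monomial_append_singleton (l : List (V × ℤ)) (p : V × ℤ) :
    M.monomial (l ++ [p]) w = M.monomial l (M.mode p.1 p.2 w) := by
  simp [monomial]

theorem monomial_zero (l : List (V × ℤ)) : M.monomial l (0 : W) = 0 := by
  induction l with
  | nil => rfl
  | cons p l ih => exact (congrArg _ ih).trans (map_zero _)

/-- A monomial in `X` with an index that is at least `T` has lower weight. -/
theorem monomial_mem_weightFiltration_of_le (hA : A.IsNGraded) {X : Set V} {T : ℤ}
    (hT : ∀ x ∈ X, ∀ n : ℤ, T ≤ n → M.mode x n w = 0) {l : List (V × ℤ)} {s : ℕ}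
    (hl : A.HasWeight l s) {p : V × ℤ} (hp : p ∈ l) (hpX : p.1 ∈ X) (hpT : T ≤ p.2) :
    M.monomial l w ∈ M.weightFiltration w s := by
  classical
  have h := monomial_sub_monomial_mem (M := M) (w := w) hA
    ((List.perm_cons_erase hp).trans (List.perm_append_singleton p _).symm) hl
  rwa [monomial_append_singleton, hT _ hpX _ hpT, monomial_zero, sub_zero] at h

/-- A subspace that contains everything of weight less than `s`, and the monomials in `X` of
weight `s` with strictly increasing indices less than `T`, contains all monomials in `X` of
weight `s`.  The relation for the mode `(u_{-1} v)_{2n+1}` trades two letters of index `n` for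
monomials of smaller length and for monomials in which the two indices are `n + j` and `n - j`
with `j ≠ 0`.  The latter increases the sum of the `(T - nᵢ)²`, which is bounded by the square of
the constant sum of the `T - nᵢ`. -/
theorem monomial_mem_of_weight {X : Set V} (hX : A.IsHomogeneousC₂Basis X) (hA : A.IsNGraded)
    {T : ℤ} (hT : ∀ x ∈ X, ∀ n : ℤ, T ≤ n → M.mode x n w = 0) {s : ℕ} {S : Submodule ℂ W}
    (hS : M.weightFiltration w s ≤ S)
    (hlt : ∀ l, A.HasWeight l s → (∀ p ∈ l, p.1 ∈ X) → l.Pairwise (fun p q => p.2 < q.2) →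
      (∀ p ∈ l, p.2 < T) → M.monomial l w ∈ S)
    {l : List (V × ℤ)} (hl : A.HasWeight l s) (hlX : ∀ p ∈ l, p.1 ∈ X) : M.monomial l w ∈ S := by
  induction hr : l.length using Nat.strong_induction_on generalizing l with
  | _ r ihr =>
    -- `m` exceeds the gap between `(∑ (T - nᵢ))²` and `∑ (T - nᵢ)²`, which is nonnegative unless
    -- some index is at least `T`.
    have key : ∀ (m : ℕ) (l : List (V × ℤ)), A.HasWeight l s → (∀ p ∈ l, p.1 ∈ X) →
        l.length = r → (l.map fun p => T - p.2).sum ^ 2 < (l.map fun p => (T - p.2) ^ 2).sum + m →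
        M.monomial l w ∈ S := by
      intro m
      induction m with
      | zero =>
        intro l hl hlX _ hm
        by_cases hlT : ∀ p ∈ l, p.2 < T
        · have := sum_map_sq_le_sq_sum_map (fun p : V × ℤ => T - p.2) (l := l)
            fun p hp => by have := hlT p hp; omega
          simp only [Nat.cast_zero, add_zero] at hm
          omega
        · push Not at hlT
          obtain ⟨p, hp, hpT⟩ := hlT
          exact hS (monomial_mem_weightFiltration_of_le hA hT hl hp (hlX p hp) hpT)
      | succ m ihm =>
        intro l hl hlX hlr hm
        by_cases hlT : ∀ p ∈ l, p.2 < T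
        swap
        · push Not at hlT
          obtain ⟨p, hp, hpT⟩ := hlT
          exact hS (monomial_mem_weightFiltration_of_le hA hT hl hp (hlX p hp) hpT)
        by_cases hn : (l.map Prod.snd).Nodup
        · obtain ⟨l', hp, hl'⟩ := exists_perm_pairwise_lt hn
          have h := hS (monomial_sub_monomial_mem (M := M) (w := w) hA hp hl)
          exact (S.sub_mem_iff_left (hlt l' (hl.perm hp) (fun p h => hlX p (hp.mem_iff.2 h)) hl'
            fun p h => hlT p (hp.mem_iff.2 h))).1 h
        · obtain ⟨u, v, n, l', hp⟩ := exists_perm_of_not_nodup hn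
          have h := hS (monomial_sub_monomial_mem (M := M) (w := w) hA hp hl)
          refine (S.sub_mem_iff_left ?_).1 h
          clear h
          have hlX' : u ∈ X ∧ v ∈ X ∧ ∀ a b, (a, b) ∈ l' → a ∈ X := by
            simpa using fun p h => hlX p (hp.mem_iff.2 h)
          obtain ⟨huX, hvX, hlX'⟩ := hlX'
          have hlr' := hp.length_eq
          simp only [List.length_cons] at hlr'
          rw [(hp.map _).sum_eq, (hp.map _).sum_eq] at hm
          simp only [List.map_cons, List.sum_cons] at hm
          have hl₀ := hl.perm hp
          cases hl₀ with
          | @cons _ _ h _ hu hl₀ =>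
          cases hl₀ with
          | @cons _ _ k t hv hl₀ =>
          have hy := monomial_mem_weightFiltration (M := M) (w := w) hl₀
          have hsq : ∀ p q : ℤ, p + q = 2 * n → p ≠ n →
              (T - n) ^ 2 + (T - n) ^ 2 + 1 ≤ (T - p) ^ 2 + (T - q) ^ 2 := fun p q hpq hpn => by
            obtain rfl : q = 2 * n - p := by omega
            have : 0 < (p - n) ^ 2 := by positivity
            nlinarith
          have hrel := M.mode_neg_one_mode_sub_mem (A.L_zero_grade _ u hu)
            (A.L_zero_grade _ v hv) (M.monomial l' w) n (S := S)
            (fun p q hpq hpn => ihm ((u, p) :: (v, q) :: l') (.cons hu (.cons hv hl₀))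
              (by simpa using ⟨huX, hvX, hlX'⟩) (by simp only [List.length_cons]; omega) (by
                simp only [List.map_cons, List.sum_cons]
                have := hsq p q hpq hpn
                rw [show T - p + (T - q + (l'.map fun p => T - p.2).sum) =
                  T - n + (T - n + (l'.map fun p => T - p.2).sum) by linarith]
                push_cast at hm
                linarith))
            (fun p q hpq hpn => ihm ((v, q) :: (u, p) :: l')
              (by rw [add_right_comm]; exact .cons hv (.cons hu hl₀))
              (by simpa using ⟨hvX, huX, hlX'⟩) (by simp only [List.length_cons]; omega) (by
                simp only [List.map_cons, List.sum_cons]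
                have := hsq p q hpq hpn
                rw [show T - q + (T - p + (l'.map fun p => T - p.2).sum) =
                  T - n + (T - n + (l'.map fun p => T - p.2).sum) by linarith]
                push_cast at hm
                linarith))
            (hS (commutator_mem_weightFiltration hA hu hv n n hy))
          have huv := mode_mem_grade hu hv (-1)
          rw [show (h : ℤ) + k - -1 - 1 = ((k + h : ℕ) : ℤ) by push_cast; ring] at huv
          refine (S.sub_mem_iff_right ?_).1 hrel
          refine mode_mem_of_forall_mem hX hA huv _ hy (by rwa [← add_assoc]) fun x hx hxk => ?_
          exact ihr (l'.length + 1) (by omega) (l := (x, 2 * n + 1) :: l')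
            (by rw [add_assoc]; exact .cons hxk hl₀) (by simpa using ⟨hx, hlX'⟩) rfl
    refine key ((l.map fun p : V × ℤ => T - p.2).sum ^ 2 + 1).toNat l hl hlX hr ?_
    have h₁ : 0 ≤ (l.map fun p => (T - p.2) ^ 2).sum :=
      List.sum_nonneg fun x hx => by
        obtain ⟨p, -, rfl⟩ := List.mem_map.1 hx
        exact sq_nonneg _
    rw [Int.toNat_of_nonneg (by positivity)]
    linarith

/-- The generated quasimodule is exhausted by the weight filtration. -/
theorem IsGeneratedBy.eq_top_of_weightFiltration_le (hA : A.IsNGraded) (hgen : M.IsGeneratedBy w)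
    {S : Submodule ℂ W} (hS : ∀ s, M.weightFiltration w s ≤ S) : S = ⊤ := by
  have htop := hgen (Submodule.span ℂ {y | ∃ l t, A.HasWeight l t ∧ y = M.monomial l w})
    (Submodule.subset_span ⟨[], 0, .nil, rfl⟩) fun v n y hy => by
      refine A.homogeneous_induction v (by simp) (fun u v hu hv => by simpa using add_mem hu hv)
        fun k v hv => ?_
      obtain rfl | ⟨k, rfl⟩ := hA.eq_zero_or_exists_nat hv
      · simp
      induction hy using Submodule.span_induction with
      | mem y hy =>
        obtain ⟨l, t, hl, rfl⟩ := hy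
        exact Submodule.subset_span ⟨(v, n) :: l, t + k, .cons hv hl, rfl⟩
      | zero => simp
      | add y z _ _ hy hz => simpa using add_mem hy hz
      | smul c y _ hy => simpa using Submodule.smul_mem _ c hy
  rw [eq_top_iff, ← htop, Submodule.span_le]
  rintro _ ⟨l, t, hl, rfl⟩
  exact hS (t + 1) (monomial_mem_weightFiltration hl)

end Quasimodule

end MobiusVertexAlgebra

/-! ### The spanning set -/

theorem theorem5p1 {V : Type*} [AddCommGroup V] [Module ℂ V] (A : MobiusVertexAlgebra V)
    (hA : A.IsNGraded) (X : Set V) (hX : A.IsHomogeneousC₂Basis X)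
    {W : Type*} [AddCommGroup W] [Module ℂ W] (M : A.Quasimodule W) (w : W)
    (hgen : M.IsGeneratedBy w) (hw : M.IsUniformlyAnnihilated X w) :
    Submodule.span ℂ {y : W | ∃ l : List (V × ℤ),
      (∀ p ∈ l, p.1 ∈ X) ∧ l.Pairwise (fun p q => p.2 < q.2) ∧
      (∀ p ∈ l, p.2 < (M.annihilationOrder X w : ℤ)) ∧ y = M.monomial l w} = ⊤ := by
  have hT : ∀ x ∈ X, ∀ n : ℤ, (M.annihilationOrder X w : ℤ) ≤ n → M.mode x n w = 0 :=
    Nat.sInf_mem hw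
  refine hgen.eq_top_of_weightFiltration_le hA fun s => ?_
  induction s with
  | zero =>
    refine Submodule.span_le.2 ?_
    rintro _ ⟨l, t, -, ht, -⟩
    exact absurd ht t.not_lt_zero
  | succ s ih =>
    refine Submodule.span_le.2 ?_
    rintro _ ⟨l, t, hl, ht, rfl⟩
    rcases Nat.lt_succ_iff_lt_or_eq.1 ht with ht | rfl
    · exact ih (Submodule.subset_span ⟨l, t, hl, ht, rfl⟩)
    · refine sup_le (Submodule.span_le.2 ?_) ih
        (MobiusVertexAlgebra.Quasimodule.monomial_mem_span_sup hX hA hl)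
      rintro _ ⟨l', hl', hlX, rfl⟩
      exact MobiusVertexAlgebra.Quasimodule.monomial_mem_of_weight hX hA hT ih
        (fun l _ h₁ h₂ h₃ => Submodule.subset_span ⟨l, h₁, h₂, h₃, rfl⟩) hl' hlX
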